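/- **Setting.** Let $\mathrm{PVAR}$ and $\mathrm{LOC}$ be countably infinite sets of program variables and locations. A memory state is a pair $(s,h)$ of a store $s:\mathrm{PVAR}\to\mathrm{LOC}$ and a heap $h$, i.e. a partial function $\mathrm{LOC}\rightharpoonup\mathrm{LOC}$ with finite domain; $h^n$ is the $n$-fold partial composition of $h$ ($h^0=\mathrm{id}$), and $h=h_1+h_2$ means that $h$ is the union of the graphs of $h_1,h_2$, whose domains are disjoint. Formulae of $\mathrm{SL}(*,\mathrm{reach}^+)$ are built from $x=y$, $x\hookrightarrow y$, $\mathrm{reach}^+(x,y)$, $\mathrm{emp}$ by $\neg,\wedge,*$, where $(s,h)\models x=y$ iff $s(x)=s(y)$; $(s,h)\models x\hookrightarrow y$ iff $h(s(x))=s(y)$; $(s,h)\models\mathrm{reach}^+(x,y)$ iff $h^n(s(x))=s(y)$ for some $n\ge1$; $(s,h)\models \mathrm{emp}$ iff $\mathrm{dom}(h)=\emptyset$; $(s,h)\models\varphi_1*\varphi_2$ iff $h=h_1+h_2$ for some $h_1,h_2$ with $(s,h_k)\models\varphi_k$ ($k=1,2$). The memory size is $\mathrm{msize}=1$ on atomic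 formulae, $\mathrm{msize}(\neg\varphi)=\mathrm{msize}(\varphi)$, $\mathrm{msize}(\varphi\wedge\psi)=\max(\mathrm{msize}(\varphi),\mathrm{msize}(\psi))$, $\mathrm{msize}(\varphi*\psi)=\mathrm{msize}(\varphi)+\mathrm{msize}(\psi)$. Fix $q$ and distinct variables $x_1,\dots,x_q$. Terms are $x_i$ and $m_q(x_i,x_j)$ ($1\le i,j\le q$). In $(s,h)$, $x_i$ denotes $s(x_i)$, and $m_q(x_i,x_j)$ denotes the unique location $\ell$ (if it exists) such that $\ell=h^{L_1}(s(x_i))=h^{L_2}(s(x_j))$ for some $L_1,L_2\ge0$ with $h^{L_1'}(s(x_i))\neq h^{L_2'}(s(x_j))$ for all $L_1'<L_1$, $L_2'\ge0$, and $h^L(\ell)=s(x_k)$ for some $L\geq 0$ and $k\in[1,q]$. Let $V$ be the set of locations denoted by terms; let $E$ be the set of pairs $(\ell,\ell')\in V^2$ with $h^L(\ell)=\ell'$ for some $L\ge1$ such that $h^{L'}(\ell)\notin V$ for $0<L'<L$; for $(\ell,\ell')\in E$ let $B(\ell,\ell')$ be the set of $\ell''$ such that $h^{L}(\ell)=\ell''$,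 $h^{L'}(\ell'')=\ell'$ for some $L,L'\ge1$ with $h^{L''}(\ell)\notin V$ for all $L''\in[1,L]$; and let $R=\mathrm{dom}(h)\setminus\big(V\cup\bigcup_{(\ell,\ell')\in E}B(\ell,\ell')\big)$. For $\alpha\ge1$, $\mathrm{Test}(q,\alpha)$ is the set of test formulae $v=v'$, $\mathrm{alloc}(v)$, $v\hookrightarrow v'$, $\mathrm{sees}_q(v,v')\ge\beta+1$, $\mathrm{sizeR}_q\ge\beta$, for terms $v,v'$ and $\beta\in[1,\alpha]$. They hold in $(s,h)$ when, respectively: $v,v'$ denote the same location; $v$ denotes a location in $\mathrm{dom}(h)$; $v,v'$ denote $\ell,\ell'$ with $(\ell,\ell')\in E$ and $B(\ell,\ell')=\emptyset$; $v,v'$ denote $\ell,\ell'$ with $(\ell,\ell')\in E$ and $|B(\ell,\ell')|\ge\beta$; $|R|\ge\beta$. Write $(s,h)\approx^q_\alpha(s',h')$ if the two memory states satisfy the same formulae of $\mathrm{Test}(q,\alpha)$. **Theorem.** 1. Every $\mathrm{SL}(*,\mathrm{reach}^+)$ formula $\varphi$ over $x_1,\dots,x_q$ is logically equivalent (satisfied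 by the same memory states) to a Boolean combination of test formulae from $\mathrm{Test}(q,\mathrm{msize}(\varphi))$. 2. If $\varphi$ is an $\mathrm{SL}(*,\mathrm{reach}^+)$ formula over $x_1,\dots,x_q$, $\alpha\ge\mathrm{msize}(\varphi)$ and $(s,h)\approx^q_\alpha(s',h')$, then $(s,h)\models\varphi$ iff $(s',h')\models\varphi$. 3. If $\alpha=\alpha_1+\alpha_2$ with $\alpha_1,\alpha_2\ge1$, $(s,h)\approx^q_\alpha(s',h')$ and $h=h_1+h_2$, then there are heaps $h_1',h_2'$ with $h'=h_1'+h_2'$, $(s,h_1)\approx^q_{\alpha_1}(s',h_1')$ and $(s,h_2)\approx^q_{\alpha_2}(s',h_2')$. -/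

import Mathlib

namespace SLReach

/-- Program variables, enumerated by `ℕ`; the `q` variables `x_1, …, x_q` are the numbers `i < q`
(so `x_i` is the number `i - 1`). -/
abbrev PVar : Type := ℕ

/-- Locations: a countably infinite set, taken to be `ℕ`. -/
abbrev Loc : Type := ℕ

/-- Stores. -/
abbrev Store : Type := PVar → Loc

/-- Heaps: partial functions on locations with a finite domain. -/
structure Heap where
  /-- the partial function; `none` means undefined -/
  val : Loc → Option Loc
  finite_dom' : {l : Loc | (val l).isSome}.Finite

namespace Heap

/-- The domain of a heap. -/
def dom (h : Heap) : Set Loc := {l : Loc | (h.val l).isSome}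

theorem finite_dom (h : Heap) : h.dom.Finite := h.finite_dom'

/-- Two heaps are disjoint when their domains are. -/
def Perp (h₁ h₂ : Heap) : Prop := h₁.dom ∩ h₂.dom = ∅

/-- The union of two heaps (only used for disjoint heaps, where it is the union of the graphs). -/
def add (h₁ h₂ : Heap) : Heap where
  val l := (h₁.val l).or (h₂.val l)
  finite_dom' := by
    refine (h₁.finite_dom.union h₂.finite_dom).subset ?_
    intro l hl
    simpa [dom] using hl

/-- `h.iter n l` is `hⁿ(l)`: the result of `n` steps from `l`, if defined. -/
def iter (h : Heap) : ℕ → Loc → Option Loc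
  | 0, l => some l
  | n + 1, l => (h.iter n l).bind h.val

theorem mem_dom_of_iter (h : Heap) {n : ℕ} (hn : 1 ≤ n) {l l' : Loc}
    (hl : h.iter n l = some l') : l ∈ h.dom := by
  induction n generalizing l' with
  | zero => omega
  | succ n ih =>
    simp only [iter, Option.bind_eq_some_iff] at hl
    obtain ⟨a, ha, hb⟩ := hl
    rcases Nat.eq_zero_or_pos n with rfl | hpos
    · simp only [iter, Option.some.injEq] at ha
      subst ha
      simp [dom, hb]
    · exact ih hpos ha

end Heap

/-! ### Formulae of separation logic with `∗` and `reach⁺` -/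

/-- Atomic formulae: `x = y`, `x ↪ y`, `reach⁺(x, y)` and `emp`. -/
inductive Atom where
  | eq (x y : PVar)
  | pto (x y : PVar)
  | reachPlus (x y : PVar)
  | emp

/-- Formulae: atomic formulae, negation, conjunction and separating conjunction. -/
inductive Formula where
  | atom (a : Atom)
  | neg (φ : Formula)
  | and (φ ψ : Formula)
  | sep (φ ψ : Formula)

/-- The variables of an atomic formula. -/
def Atom.vars : Atom → Set PVar
  | .eq x y => {x, y}
  | .pto x y => {x, y}
  | .reachPlus x y => {x, y}
  | .emp => ∅

/-- The variables of a formula. -/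
def Formula.vars : Formula → Set PVar
  | .atom a => a.vars
  | .neg φ => φ.vars
  | .and φ ψ => φ.vars ∪ ψ.vars
  | .sep φ ψ => φ.vars ∪ ψ.vars

/-- The formula is built over the first `q` program variables. -/
def Formula.BuiltOver (q : ℕ) (φ : Formula) : Prop := ∀ x ∈ φ.vars, x < q

/-- The memory size of a formula. -/
def Formula.msize : Formula → ℕ
  | .atom _ => 1
  | .neg φ => φ.msize
  | .and φ ψ => max φ.msize ψ.msize
  | .sep φ ψ => φ.msize + ψ.msize

/-- Satisfaction of atomic formulae in the memory state `(s, h)`. -/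
def Atom.Sat (s : Store) (h : Heap) : Atom → Prop
  | .eq x y => s x = s y
  | .pto x y => h.val (s x) = some (s y)
  | .reachPlus x y => ∃ n : ℕ, 1 ≤ n ∧ h.iter n (s x) = some (s y)
  | .emp => h.dom = ∅

/-- Satisfaction of formulae in the memory state `(s, h)`. -/
def Formula.Sat (s : Store) : Heap → Formula → Prop
  | h, .atom a => a.Sat s h
  | h, .neg φ => ¬ φ.Sat s h
  | h, .and φ ψ => φ.Sat s h ∧ ψ.Sat s h
  | h, .sep φ ψ => ∃ h₁ h₂ : Heap, h₁.Perp h₂ ∧ h₁.add h₂ = h ∧ φ.Sat s h₁ ∧ ψ.Sat s h₂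

/-! ### Terms, meet-points and the support graph -/

/-- Terms: the variables `x_1, …, x_q` and the meet-point terms `m_q(x_i, x_j)`. -/
inductive MTerm (q : ℕ) where
  | var (i : Fin q)
  | meet (i j : Fin q)

/-- `l` is the meet-point of the `i`-th and the `j`-th variable: the first location reachable from
the `i`-th variable that is also reachable from the `j`-th one, provided that it reaches the
location of one of the `q` variables. -/
def IsMeet (q : ℕ) (s : Store) (h : Heap) (i j : Fin q) (l : Loc) : Prop :=
  ∃ L₁ L₂ : ℕ, (h.iter L₁ (s i) = some l ∧ h.iter L₂ (s j) = some l) ∧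
    (∀ L₁' < L₁, ∀ L₂' : ℕ, h.iter L₁' (s i) ≠ h.iter L₂' (s j)) ∧
    (∃ (k : Fin q) (L : ℕ), h.iter L l = some (s k))

/-- The (partial) interpretation of terms: `Denotes s h t l` means that the value of `t` in the
memory state `(s, h)` is defined and equal to `l`. -/
def Denotes {q : ℕ} (s : Store) (h : Heap) : MTerm q → Loc → Prop
  | .var i, l => s i = l
  | .meet i j, l => IsMeet q s h i j l

/-- A term has at most one value. -/
theorem Denotes.unique {q : ℕ} {s : Store} {h : Heap} {t : MTerm q} {l l' : Loc}
    (hl : Denotes s h t l) (hl' : Denotes s h t l') : l = l' := by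
  cases t with
  | var i => exact hl.symm.trans hl'
  | meet i j =>
    obtain ⟨L₁, L₂, ⟨h1, h2⟩, hmin, -⟩ := hl
    obtain ⟨M₁, M₂, ⟨g1, g2⟩, gmin, -⟩ := hl'
    rcases lt_trichotomy L₁ M₁ with hlt | heq | hgt
    · exact absurd (h1.trans h2.symm) (gmin L₁ hlt L₂)
    · subst heq
      exact Option.some.inj (h1.symm.trans g1)
    · exact absurd (g1.trans g2.symm) (hmin M₁ hgt M₂)

/-- The labelled locations, i.e. the vertices of the support graph. -/
def Labels (q : ℕ) (s : Store) (h : Heap) : Set Loc := {l | ∃ t : MTerm q, Denotes s h t l}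

/-- The edges of the support graph: non-empty paths between labelled locations without labelled
intermediate locations. -/
def Edge (q : ℕ) (s : Store) (h : Heap) (l l' : Loc) : Prop :=
  l ∈ Labels q s h ∧ l' ∈ Labels q s h ∧ ∃ L : ℕ, 1 ≤ L ∧ h.iter L l = some l' ∧
    ∀ L' : ℕ, 0 < L' → L' < L → ∀ m ∈ Labels q s h, h.iter L' l ≠ some m

/-- The allocated labelled locations. -/
def AllocSet (q : ℕ) (s : Store) (h : Heap) : Set Loc := Labels q s h ∩ h.dom

/-- The locations strictly between the ends of an edge `(l, l')` of the support graph. -/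
def Btw (q : ℕ) (s : Store) (h : Heap) (l l' : Loc) : Set Loc :=
  {m | ∃ L L' : ℕ, 1 ≤ L ∧ 1 ≤ L' ∧ h.iter L l = some m ∧ h.iter L' m = some l' ∧
    ∀ L'' : ℕ, 1 ≤ L'' → L'' ≤ L → ∀ v ∈ Labels q s h, h.iter L'' l ≠ some v}

/-- The remaining memory cells. -/
def Rem (q : ℕ) (s : Store) (h : Heap) : Set Loc :=
  h.dom \ (AllocSet q s h ∪ {m | ∃ l l' : Loc, Edge q s h l l' ∧ m ∈ Btw q s h l l'})

theorem finite_btw (q : ℕ) (s : Store) (h : Heap) (l l' : Loc) : (Btw q s h l l').Finite := by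
  refine h.finite_dom.subset ?_
  rintro m ⟨L, L', -, hL', -, hm, -⟩
  exact h.mem_dom_of_iter hL' hm

theorem finite_rem (q : ℕ) (s : Store) (h : Heap) : (Rem q s h).Finite :=
  h.finite_dom.subset Set.sdiff_subset

/-! ### Test formulae -/

/-- Atomic test formulae over the terms with `q` variables (thresholds not yet bounded). The
formula `sees t t' β` stands for `sees_q(t, t') ≥ β + 1`. -/
inductive TestFormula (q : ℕ) where
  | eq (t t' : MTerm q)
  | alloc (t : MTerm q)
  | pto (t t' : MTerm q)
  | sees (t t' : MTerm q) (β : ℕ)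
  | sizeR (β : ℕ)

/-- `Test q α`: the test formulae whose parameter `β` lies in `[1, α]`. -/
def Test (q α : ℕ) : Set (TestFormula q)
  | .eq _ _ => True
  | .alloc _ => True
  | .pto _ _ => True
  | .sees _ _ β => 1 ≤ β ∧ β ≤ α
  | .sizeR β => 1 ≤ β ∧ β ≤ α

/-- Satisfaction of test formulae, through the support graph. -/
def TestFormula.Sat {q : ℕ} (s : Store) (h : Heap) : TestFormula q → Prop
  | .eq t t' => ∃ l : Loc, Denotes s h t l ∧ Denotes s h t' l
  | .alloc t => ∃ l ∈ AllocSet q s h, Denotes s h t l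
  | .pto t t' => ∃ l l' : Loc, Edge q s h l l' ∧ Denotes s h t l ∧ Denotes s h t' l' ∧
      (Btw q s h l l').ncard = 0
  | .sees t t' β => ∃ l l' : Loc, Edge q s h l l' ∧ Denotes s h t l ∧ Denotes s h t' l' ∧
      β ≤ (Btw q s h l l').ncard
  | .sizeR β => β ≤ (Rem q s h).ncard

/-- Boolean combinations of elements of `A`. -/
inductive BoolComb (A : Type) where
  | atom (a : A)
  | neg (χ : BoolComb A)
  | and (χ χ' : BoolComb A)

/-- Satisfaction of a Boolean combination of test formulae from `Test q α`. -/
def BoolComb.Sat {q α : ℕ} (s : Store) (h : Heap) : BoolComb (Test q α) → Prop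
  | .atom ψ => ψ.1.Sat s h
  | .neg χ => ¬ χ.Sat s h
  | .and χ χ' => χ.Sat s h ∧ χ'.Sat s h

/-- The indistinguishability relation: `(s, h)` and `(s', h')` satisfy the same test formulae. -/
def Indist (q α : ℕ) (s : Store) (h : Heap) (s' : Store) (h' : Heap) : Prop :=
  ∀ ψ ∈ Test q α, ψ.Sat s h ↔ ψ.Sat s' h'

end SLReach

/-! A memory state is described by markers: a finite family of locations containing the values of
the variables, such that every location strictly between markers has only one last marker before it
(`Heap.Separated`). Markers sort the domain into classes (`Cell`): allocated markers, one segment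
after each marker, and the rest. `Sim` says that two states have corresponding markers, the same
marker-to-marker walks, and class sizes that agree up to `α`.

`Sim` and `Indist` are linked in both directions. The labels themselves are legitimate markers
(`separated_labels`), and the test formulae record exactly the data that `Sim` asks for, so `Indist`
yields a `Sim` on labels (`Indist.exists_sim`). Conversely, `Sim` for any finite family of markers
yields `Indist` (`Sim.indist`): meet-points are forced to be markers, labels and edges are
determined by walks between markers, and the counted sets are unions of classes.

This freedom of markers makes heap splitting tractable. A piece of a heap may have fewer labels than
the whole, but the old labels remain valid markers for it. To answer a splitting of `h`, each class
of the other heap is split separately, with sizes matching up to `α₁` and `α₂` (`exists_split_set`).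
Which segments survive depends only on whether some parts of classes are empty, so both pieces are
again similar (`Sim.exists_restrict`), which is part 3. Part 2 follows by induction on the formula,
with part 3 for `∗`. Part 1 follows because there are finitely many test formulae and their truth
values decide the formula. -/

namespace SLReach

/-! ### Iteration, walks and segments between marked locations. -/

namespace Heap

theorem iter_add (h : Heap) (m n : ℕ) (l : Loc) :
    h.iter (m + n) l = (h.iter m l).bind (h.iter n) := by
  induction n with
  | zero => simp [iter]
  | succ n ih => rw [← Nat.add_assoc, iter, ih, Option.bind_assoc]; rfl

theorem iter_trans {h : Heap} {m n : ℕ} {u v w : Loc} (huv : h.iter m u = some v)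
    (hvw : h.iter n v = some w) : h.iter (m + n) u = some w := by
  rw [iter_add, huv]; exact hvw

theorem iter_split {h : Heap} {k n : ℕ} {u w : Loc} (hn : h.iter n u = some w) (hk : k ≤ n) :
    ∃ v, h.iter k u = some v ∧ h.iter (n - k) v = some w := by
  have := iter_add h k (n - k) u
  rw [Nat.add_sub_cancel' hk, hn] at this
  exact Option.bind_eq_some_iff.1 this.symm

theorem iter_sub {h : Heap} {k n : ℕ} {u v w : Loc} (hn : h.iter n u = some w)
    (hv : h.iter k u = some v) (hk : k ≤ n) : h.iter (n - k) v = some w := by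
  obtain ⟨v', hv', hw⟩ := iter_split hn hk
  rw [hv] at hv'
  cases hv'
  exact hw

theorem iter_mul {h : Heap} {p : ℕ} {u : Loc} (hp : h.iter p u = some u) (k : ℕ) :
    h.iter (k * p) u = some u := by
  induction k with
  | zero => simp [iter]
  | succ k ih => rw [Nat.succ_mul]; exact iter_trans ih hp

/-- Iteration is injective on periodic locations. -/
theorem iter_inj_of_periodic {h : Heap} {p p' n : ℕ} {u v w : Loc} (hp : 1 ≤ p) (hp' : 1 ≤ p')
    (hu : h.iter p u = some u) (hv : h.iter p' v = some v) (huw : h.iter n u = some w)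
    (hvw : h.iter n v = some w) : u = v := by
  -- `n * (p * p')` is a multiple of both periods and at least `n`, so continuing from the common
  -- image `w` for the remaining steps returns both to `u` and to `v`.
  have hle : n ≤ n * (p * p') := Nat.le_mul_of_pos_right _ (Nat.mul_pos hp hp')
  have h1 : h.iter (n * (p * p')) u = some u := by
    rw [mul_comm p p', ← mul_assoc]; exact iter_mul hu _
  have h2 : h.iter (n * (p * p')) v = some v := by
    rw [← mul_assoc]; exact iter_mul hv _
  have h3 := iter_sub h1 huw hle
  have h4 := iter_sub h2 hvw hle
  exact Option.some.inj (h3.symm.trans h4)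

/-- `v` is reachable from `u` in any number of steps. -/
def Reach (h : Heap) (u v : Loc) : Prop := ∃ n : ℕ, h.iter n u = some v

theorem Reach.refl (h : Heap) (u : Loc) : h.Reach u u := ⟨0, rfl⟩

theorem Reach.trans {h : Heap} {u v w : Loc} (h₁ : h.Reach u v) (h₂ : h.Reach v w) :
    h.Reach u w := by
  obtain ⟨m, hm⟩ := h₁
  obtain ⟨n, hn⟩ := h₂
  exact ⟨m + n, iter_trans hm hn⟩

/-- There is a non-empty path from `u` to `m` whose intermediate locations avoid `A`. -/
def Walk (h : Heap) (A : Set Loc) (u m : Loc) : Prop :=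
  ∃ n : ℕ, 1 ≤ n ∧ h.iter n u = some m ∧
    ∀ k : ℕ, 0 < k → k < n → ∀ v ∈ A, h.iter k u ≠ some v

theorem Walk.mono {h : Heap} {A B : Set Loc} {u m : Loc} (hw : h.Walk B u m) (hAB : A ⊆ B) :
    h.Walk A u m := by
  obtain ⟨n, hn, hm, hf⟩ := hw
  exact ⟨n, hn, hm, fun k hk hkn v hv => hf k hk hkn v (hAB hv)⟩

theorem Walk.reach {h : Heap} {A : Set Loc} {u m : Loc} (hw : h.Walk A u m) : h.Reach u m := by
  obtain ⟨n, -, hm, -⟩ := hw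
  exact ⟨n, hm⟩

theorem Walk.mem_dom {h : Heap} {A : Set Loc} {u m : Loc} (hw : h.Walk A u m) : u ∈ h.dom := by
  obtain ⟨n, hn, hm, -⟩ := hw
  exact h.mem_dom_of_iter hn hm

theorem Walk.trans {h : Heap} {A : Set Loc} {u v w : Loc} (h₁ : h.Walk A u v) (hv : v ∉ A)
    (h₂ : h.Walk A v w) : h.Walk A u w := by
  obtain ⟨m, hm, hmv, hf₁⟩ := h₁
  obtain ⟨n, hn, hnw, hf₂⟩ := h₂
  refine ⟨m + n, by omega, iter_trans hmv hnw, fun k hk hkn x hx hkx => ?_⟩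
  rcases lt_trichotomy k m with hlt | rfl | hgt
  · exact hf₁ k hk hlt x hx hkx
  · rw [hmv] at hkx
    cases hkx
    exact hv hx
  · refine hf₂ (k - m) (by omega) (by omega) x hx ?_
    exact iter_sub hkx hmv hgt.le

theorem walk_of_val {h : Heap} (A : Set Loc) {u m : Loc} (hm : h.val u = some m) :
    h.Walk A u m :=
  ⟨1, le_rfl, by simpa [iter] using hm, fun k hk hk1 => by omega⟩

/-- Two walks from the same source that end at avoided locations have the same end. -/
theorem Walk.unique {h : Heap} {A : Set Loc} {u v w : Loc} (hv : v ∈ A) (hw : w ∈ A)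
    (h₁ : h.Walk A u v) (h₂ : h.Walk A u w) : v = w := by
  obtain ⟨m, hm, hmv, hf₁⟩ := h₁
  obtain ⟨n, hn, hnw, hf₂⟩ := h₂
  rcases lt_trichotomy m n with hlt | rfl | hgt
  · exact absurd hmv (hf₂ m hm hlt v hv)
  · exact Option.some.inj (hmv.symm.trans hnw)
  · exact absurd hnw (hf₁ n hn hgt w hw)

/-- A walk to a location outside `A` is a part of the walk to the next location in `A`. -/
theorem Walk.remainder {h : Heap} {A : Set Loc} {u m v : Loc} (h₁ : h.Walk A u m) (hm : m ∉ A)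
    (hv : v ∈ A) (h₂ : h.Walk A u v) : h.Walk A m v := by
  obtain ⟨j, hj, hjm, hf₁⟩ := h₁
  obtain ⟨n, hn, hnv, hf₂⟩ := h₂
  rcases lt_trichotomy j n with hlt | rfl | hgt
  · refine ⟨n - j, by omega, iter_sub hnv hjm hlt.le, fun k hk hkn x hx hkx => ?_⟩
    exact hf₂ (j + k) (by omega) (by omega) x hx (iter_trans hjm hkx)
  · rw [hjm] at hnv
    cases hnv
    exact absurd hv hm
  · exact absurd hnv (hf₁ n hn hgt v hv)

/-- The first visit of a path to `A`. -/
theorem exists_walk_to {h : Heap} {A : Set Loc} {n : ℕ} {m w : Loc} (hn : 1 ≤ n)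
    (hw : w ∈ A) (hmw : h.iter n m = some w) : ∃ v ∈ A, h.Walk A m v := by
  classical
  have hex : ∃ k, 1 ≤ k ∧ ∃ v ∈ A, h.iter k m = some v := ⟨n, hn, w, hw, hmw⟩
  obtain ⟨h1, v, hv, hmv⟩ := Nat.find_spec hex
  refine ⟨v, hv, _, h1, hmv, fun k hk hkn x hx hkx => ?_⟩
  exact Nat.find_min hex hkn ⟨hk, x, hx, hkx⟩

theorem Reach.exists_walk {h : Heap} {A : Set Loc} {m w : Loc} (hm : m ∉ A) (hw : w ∈ A)
    (hmw : h.Reach m w) : ∃ v ∈ A, h.Walk A m v := by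
  obtain ⟨n, hn⟩ := hmw
  rcases Nat.eq_zero_or_pos n with rfl | hpos
  · cases hn
    exact absurd hw hm
  · exact exists_walk_to hpos hw hn

/-- The last visit of a path to `A`. -/
theorem exists_walk_from {h : Heap} {A : Set Loc} {n : ℕ} {u m : Loc} (hu : u ∈ A)
    (hm : m ∉ A) (hum : h.iter n u = some m) :
    ∃ k < n, ∃ v ∈ A, h.iter k u = some v ∧ h.Walk A v m := by
  induction n generalizing m with
  | zero =>
    cases hum
    exact absurd hu hm
  | succ n ih =>
    obtain ⟨p, hp, hpm⟩ := Option.bind_eq_some_iff.1 hum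
    by_cases hpA : p ∈ A
    · exact ⟨n, by omega, p, hpA, hp, walk_of_val A hpm⟩
    · obtain ⟨k, hk, v, hv, hkv, hw⟩ := ih hpA hp
      exact ⟨k, by omega, v, hv, hkv, hw.trans hpA (walk_of_val A hpm)⟩

theorem Reach.eq_or_walk {h : Heap} {u v : Loc} (huv : h.Reach u v) : u = v ∨ h.Walk ∅ u v := by
  obtain ⟨n, hn⟩ := huv
  rcases Nat.eq_zero_or_pos n with rfl | hpos
  · exact .inl (Option.some.inj hn)
  · exact .inr ⟨n, hpos, hn, fun k _ _ v hv => absurd hv (Set.notMem_empty v)⟩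

/-- `m` lies on a path from `u` to `A`, strictly before the next location in `A`. -/
def SegAt (h : Heap) (A : Set Loc) (u m : Loc) : Prop :=
  m ∉ A ∧ h.Walk A u m ∧ ∃ w ∈ A, h.Reach m w

theorem SegAt.walk {h : Heap} {A : Set Loc} {u m : Loc} (hs : h.SegAt A u m) :
    ∃ v ∈ A, h.Walk A u v ∧ h.Walk A m v := by
  obtain ⟨hm, hw, w, hwA, hr⟩ := hs
  obtain ⟨v, hv, hmv⟩ := hr.exists_walk hm hwA
  exact ⟨v, hv, hw.trans hm hmv, hmv⟩

theorem SegAt.mem_dom {h : Heap} {A : Set Loc} {u m : Loc} (hs : h.SegAt A u m) : m ∈ h.dom := by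
  obtain ⟨v, -, -, hw⟩ := hs.walk
  exact hw.mem_dom

/-- Every location strictly between two locations in `A` has a unique last predecessor in `A`. -/
def Separated (h : Heap) (A : Set Loc) : Prop :=
  ∀ u₁ ∈ A, ∀ u₂ ∈ A, ∀ m, h.SegAt A u₁ m → h.SegAt A u₂ m → u₁ = u₂

/-- The last visit to `A` on the way to `m` supplies the marker that opens the segment. Consequently
the unclassified rest never lies on a path between markers. -/
theorem mem_or_segAt {h : Heap} {A : Set Loc} {u m w : Loc} (hu : u ∈ A) (hw : w ∈ A)
    (hum : h.Reach u m) (hmw : h.Reach m w) : m ∈ A ∨ ∃ v ∈ A, h.SegAt A v m := by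
  by_cases hm : m ∈ A
  · exact .inl hm
  · obtain ⟨n, hn⟩ := hum
    obtain ⟨k, -, v, hv, -, hvm⟩ := exists_walk_from hu hm hn
    exact .inr ⟨v, hv, hm, hvm, w, hw, hmw⟩

end Heap

open Heap

/-! ### Counting up to a threshold. -/

section Count

theorem min_add_eq_of_min_eq {α m n m' n' : ℕ} (h₁ : min α m = min α m')
    (h₂ : min α n = min α n') : min α (m + n) = min α (m' + n') := by
  omega

/-- Two sets that are unions of corresponding classes have the same size up to a threshold. -/
theorem min_ncard_eq_of_classes {κ : Type*} [Finite κ] {α : ℕ} (hα : 1 ≤ α)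
    {C C' : κ → Set Loc} (hfin : ∀ c, (C c).Finite) (hfin' : ∀ c, (C' c).Finite)
    (hdisj : Pairwise fun c d => Disjoint (C c) (C d))
    (hdisj' : Pairwise fun c d => Disjoint (C' c) (C' d))
    (hmin : ∀ c, min α (C c).ncard = min α (C' c).ncard)
    {S S' : Set Loc} (hS : S ⊆ ⋃ c, C c) (hS' : S' ⊆ ⋃ c, C' c)
    (hsat : ∀ c, ∀ m ∈ C c, ∀ m' ∈ C' c, (m ∈ S ↔ m' ∈ S')) :
    min α S.ncard = min α S'.ncard := by
  classical
  cases nonempty_fintype κ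
  have hempty : ∀ c, C c = ∅ ↔ C' c = ∅ := fun c => by
    rw [← Set.ncard_eq_zero (hfin c), ← Set.ncard_eq_zero (hfin' c)]
    have := hmin c
    omega
  -- Since every member of one class is compared with every member of the other, a nonempty class
  -- lies inside `S` or misses it, and its partner does the same; `hα` makes the thresholds detect
  -- emptiness.
  have hpart : ∀ c, min α (C c ∩ S).ncard = min α (C' c ∩ S').ncard := fun c => by
    rcases (C c).eq_empty_or_nonempty with he | ⟨m, hm⟩
    · rw [he, (hempty c).1 he, Set.empty_inter, Set.empty_inter]
    · obtain ⟨m', hm'⟩ : (C' c).Nonempty := by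
        rw [Set.nonempty_iff_ne_empty, ne_eq, ← hempty c]
        exact Set.nonempty_iff_ne_empty.1 ⟨m, hm⟩
      by_cases hmS : m ∈ S
      · have hm'S := (hsat c m hm m' hm').1 hmS
        rw [Set.inter_eq_left.2 fun x hx => (hsat c x hx m' hm').2 hm'S,
          Set.inter_eq_left.2 fun x hx => (hsat c m hm x hx).1 hmS, hmin c]
      · have hm'S := fun h => hmS ((hsat c m hm m' hm').2 h)
        have h1 : C c ∩ S = ∅ := Set.eq_empty_of_forall_notMem
          fun x hx => hm'S ((hsat c x hx.1 m' hm').1 hx.2)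
        have h2 : C' c ∩ S' = ∅ := Set.eq_empty_of_forall_notMem
          fun x hx => hmS ((hsat c m hm x hx.1).2 hx.2)
        rw [h1, h2]
  have key : ∀ T : Finset κ, min α (⋃ c ∈ T, C c ∩ S).ncard = min α (⋃ c ∈ T, C' c ∩ S').ncard := by
    intro T
    induction T using Finset.induction_on with
    | empty => simp
    | insert c T hc ih =>
      have fin : ∀ {D : κ → Set Loc} {R : Set Loc}, (∀ c, (D c).Finite) →
          (⋃ d ∈ T, D d ∩ R).Finite := fun hD =>
        T.finite_toSet.biUnion fun d _ => (hD d).inter_of_left _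
      have dis : ∀ {D : κ → Set Loc} {R : Set Loc}, (Pairwise fun c d => Disjoint (D c) (D d)) →
          Disjoint (D c ∩ R) (⋃ d ∈ T, D d ∩ R) := fun hD => by
        rw [Set.disjoint_iUnion₂_right]
        intro d hd
        exact (hD (by rintro rfl; exact hc hd)).mono Set.inter_subset_left Set.inter_subset_left
      rw [Finset.set_biUnion_insert, Finset.set_biUnion_insert,
        Set.ncard_union_eq (dis hdisj) ((hfin c).inter_of_left _) (fin hfin),
        Set.ncard_union_eq (dis hdisj') ((hfin' c).inter_of_left _) (fin hfin')]
      exact min_add_eq_of_min_eq (hpart c) ih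
  have all : ∀ {D : κ → Set Loc} {R : Set Loc}, R ⊆ ⋃ c, D c →
      (⋃ c ∈ (Finset.univ : Finset κ), D c ∩ R) = R := fun {D R} hR => by
    simp only [Finset.mem_univ, Set.iUnion_true, ← Set.iUnion_inter]
    exact Set.inter_eq_right.2 hR
  have := key Finset.univ
  rwa [all hS, all hS'] at this

end Count

/-! ### Markers, classes of cells and similarity. -/

/-- The cells of a heap, classified by the markers `a`: marked cells, cells strictly between two
consecutive markers (classified by the first one), and the remaining cells. -/
def Cell {I : Type} (h : Heap) (a : I → Loc) : I ⊕ Option I → Set Loc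
  | .inl i => {m | m = a i ∧ m ∈ h.dom}
  | .inr (some i) => {m | h.SegAt (Set.range a) (a i) m}
  | .inr none => {m | m ∈ h.dom ∧ m ∉ Set.range a ∧ ∀ i, ¬ h.SegAt (Set.range a) (a i) m}

theorem cell_subset_dom {I : Type} (h : Heap) (a : I → Loc) (c : I ⊕ Option I) :
    Cell h a c ⊆ h.dom := by
  rcases c with i | _ | i
  · exact fun m hm => hm.2
  · exact fun m hm => hm.1
  · exact fun m hm => hm.mem_dom

theorem dom_subset_iUnion_cell {I : Type} (h : Heap) (a : I → Loc) :
    h.dom ⊆ ⋃ c, Cell h a c := by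
  intro m hm
  rw [Set.mem_iUnion]
  by_cases h1 : m ∈ Set.range a
  · obtain ⟨i, rfl⟩ := h1
    exact ⟨.inl i, rfl, hm⟩
  · by_cases h2 : ∃ i, h.SegAt (Set.range a) (a i) m
    · obtain ⟨i, hi⟩ := h2
      exact ⟨.inr (some i), hi⟩
    · exact ⟨.inr none, hm, h1, not_exists.1 h2⟩

theorem finite_cell {I : Type} (h : Heap) (a : I → Loc) (c : I ⊕ Option I) :
    (Cell h a c).Finite :=
  h.finite_dom.subset (cell_subset_dom h a c)

theorem pairwise_disjoint_cell {I : Type} {h : Heap} {a : I → Loc} (ha : Function.Injective a)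
    (hsep : h.Separated (Set.range a)) :
    Pairwise fun c d => Disjoint (Cell h a c) (Cell h a d) := by
  intro c d hcd
  rw [Set.disjoint_left]
  intro m hc hd
  apply hcd
  rcases c with i | _ | i <;> rcases d with j | _ | j
  · rw [ha (hc.1.symm.trans hd.1)]
  · exact absurd ⟨i, hc.1.symm⟩ hd.2.1
  · exact absurd ⟨i, hc.1.symm⟩ hd.1
  · exact absurd ⟨j, hd.1.symm⟩ hc.2.1
  · rfl
  · exact absurd hd (hc.2.2 j)
  · exact absurd ⟨j, hd.1.symm⟩ hc.1
  · exact absurd hc (hd.2.2 i)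
  · rw [ha (hsep _ ⟨i, rfl⟩ _ ⟨j, rfl⟩ m hc hd)]

/-- Two memory states are similar, up to the threshold `α`, with respect to corresponding markers
`a` and `a'` that include the values of the `q` variables. -/
structure Sim (q α : ℕ) {I : Type} (s : Store) (h : Heap) (a : I → Loc)
    (s' : Store) (h' : Heap) (a' : I → Loc) : Prop where
  inj : Function.Injective a
  inj' : Function.Injective a'
  vars : ∀ x : Fin q, ∃ i, a i = s x ∧ a' i = s' x
  sep : h.Separated (Set.range a)
  sep' : h'.Separated (Set.range a')
  walk_iff : ∀ i j, h.Walk (Set.range a) (a i) (a j) ↔ h'.Walk (Set.range a') (a' i) (a' j)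
  card : ∀ c, min α (Cell h a c).ncard = min α (Cell h' a' c).ncard

/-- Locations in the same position with respect to the markers. -/
def Similar {I : Type} (h : Heap) (a : I → Loc) (h' : Heap) (a' : I → Loc) (m m' : Loc) : Prop :=
  (∃ i, m = a i ∧ m' = a' i) ∨
    ∃ i, h.SegAt (Set.range a) (a i) m ∧ h'.SegAt (Set.range a') (a' i) m'

theorem Similar.symm {I : Type} {h h' : Heap} {a a' : I → Loc} {m m' : Loc}
    (hZ : Similar h a h' a' m m') : Similar h' a' h a m' m := by
  rcases hZ with ⟨i, h1, h2⟩ | ⟨i, h1, h2⟩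
  · exact .inl ⟨i, h2, h1⟩
  · exact .inr ⟨i, h2, h1⟩

theorem Similar.eq_of_left {I : Type} {h h' : Heap} {a a' : I → Loc} (ha : Function.Injective a)
    {i : I} {m' : Loc} (hZ : Similar h a h' a' (a i) m') : m' = a' i := by
  rcases hZ with ⟨j, h1, h2⟩ | ⟨j, h1, h2⟩
  · rw [h2, ha h1]
  · exact absurd ⟨i, rfl⟩ h1.1

theorem similar_self {I : Type} (h : Heap) (a : I → Loc) (h' : Heap) (a' : I → Loc) (i : I) :
    Similar h a h' a' (a i) (a' i) := .inl ⟨i, rfl, rfl⟩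

/-! ### Similar states satisfy the same test formulae. -/

/-- A meet-point is marked. -/
theorem isMeet_mem_of_separated {q : ℕ} {s : Store} {h : Heap} {A : Set Loc}
    (hvars : ∀ x : Fin q, s x ∈ A) (hsep : h.Separated A) {x y : Fin q} {l : Loc}
    (hl : IsMeet q s h x y l) : l ∈ A := by
  obtain ⟨L₁, L₂, ⟨h1, h2⟩, hmin, z, L, hz⟩ := hl
  by_contra hlA
  obtain ⟨k₁, hk₁, u₁, hu₁, hxu, hw₁⟩ := exists_walk_from (hvars x) hlA h1
  obtain ⟨k₂, -, u₂, hu₂, hyu, hw₂⟩ := exists_walk_from (hvars y) hlA h2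
  have hr : ∃ w ∈ A, h.Reach l w := ⟨s z, hvars z, L, hz⟩
  -- An unmarked meet-point would have the same last marker on both incoming paths, so the paths
  -- would already have met there, after `k₁ < L₁` steps.
  have := hsep u₁ hu₁ u₂ hu₂ l ⟨hlA, hw₁, hr⟩ ⟨hlA, hw₂, hr⟩
  subst this
  exact hmin k₁ hk₁ k₂ (hxu.trans hyu.symm)

/-- The locations between the ends of an edge are the unlabelled ones that its source reaches
without visiting a label. -/
theorem btw_eq_of_edge {q : ℕ} {s : Store} {h : Heap} {l l' : Loc} (he : Edge q s h l l') :
    Btw q s h l l' = {m | m ∉ Labels q s h ∧ h.Walk (Labels q s h) l m} := by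
  obtain ⟨-, hl', hw⟩ := he
  ext m
  constructor
  · rintro ⟨L, L', hL, -, hm, -, hf⟩
    exact ⟨fun hmL => hf L hL le_rfl m hmL hm, L, hL, hm, fun k hk hkL => hf k hk hkL.le⟩
  · rintro ⟨hmL, hwm⟩
    obtain ⟨L', hL', hml', -⟩ := hwm.remainder hmL hl' hw
    obtain ⟨L, hL, hm, hf⟩ := hwm
    refine ⟨L, L', hL, hL', hm, hml', fun k hk hkL v hv hkv => ?_⟩
    rcases hkL.lt_or_eq with hlt | rfl
    · exact hf k hk hlt v hv hkv
    · rw [hm] at hkv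
      cases hkv
      exact hmL hv

namespace Sim

variable {q α : ℕ} {I : Type} {s s' : Store} {h h' : Heap} {a a' : I → Loc}

theorem symm (H : Sim q α s h a s' h' a') : Sim q α s' h' a' s h a where
  inj := H.inj'
  inj' := H.inj
  vars x := (H.vars x).imp fun _ hi => hi.symm
  sep := H.sep'
  sep' := H.sep
  walk_iff i j := (H.walk_iff i j).symm
  card c := (H.card c).symm

theorem cell_nonempty (H : Sim q α s h a s' h' a') (hα : 1 ≤ α) {c : I ⊕ Option I}
    (hc : (Cell h a c).Nonempty) : (Cell h' a' c).Nonempty := by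
  rw [← Set.ncard_pos (finite_cell _ _ _)] at hc ⊢
  have := H.card c
  omega

theorem mem_dom (H : Sim q α s h a s' h' a') (hα : 1 ≤ α) {i : I} (hi : a i ∈ h.dom) :
    a' i ∈ h'.dom := by
  obtain ⟨m, hm, hd⟩ := H.cell_nonempty hα (c := .inl i) ⟨a i, rfl, hi⟩
  exact hm ▸ hd

theorem var_mem_range (H : Sim q α s h a s' h' a') (x : Fin q) : s x ∈ Set.range a :=
  (H.vars x).imp fun _ hi => hi.1

/-- Partners exist but are not canonical: any cell of the corresponding segment will do, since walks
from markers do not tell the cells of one segment apart. -/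
theorem exists_similar (H : Sim q α s h a s' h' a') (hα : 1 ≤ α) {m : Loc}
    (hm : m ∈ Set.range a ∨ ∃ v ∈ Set.range a, h.SegAt (Set.range a) v m) :
    ∃ m', Similar h a h' a' m m' := by
  rcases hm with ⟨i, rfl⟩ | ⟨_, ⟨i, rfl⟩, hi⟩
  · exact ⟨a' i, similar_self h a h' a' i⟩
  · obtain ⟨m', hm'⟩ := H.cell_nonempty hα (c := .inr (some i)) ⟨m, hi⟩
    exact ⟨m', .inr ⟨i, hi, hm'⟩⟩

/-- Walks from a marker that avoid a set of markers transfer. -/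
theorem walk (H : Sim q α s h a s' h' a') (J : Set I) {i : I} {m m' : Loc}
    (hw : h.Walk (a '' J) (a i) m) (hZ : Similar h a h' a' m m') :
    h'.Walk (a' '' J) (a' i) m' := by
  obtain ⟨n, hn, hm, hf⟩ := hw
  induction n using Nat.strong_induction_on generalizing i m m' with
  | _ n ih =>
  -- The walk avoids only the markers in `J`. If it meets no marker at all, `walk_iff` or separation
  -- applies; otherwise it is cut at a marker outside `J` and both halves are shorter.
  by_cases hfree : ∀ k, 0 < k → k < n → ∀ v ∈ Set.range a, h.iter k (a i) ≠ some v
  · have hw : h.Walk (Set.range a) (a i) m := ⟨n, hn, hm, hfree⟩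
    refine Walk.mono ?_ (Set.image_subset_range a' J)
    rcases hZ with ⟨j, rfl, rfl⟩ | ⟨j, hj, hj'⟩
    · exact (H.walk_iff i j).1 hw
    · have := H.inj (H.sep _ ⟨i, rfl⟩ _ ⟨j, rfl⟩ m ⟨hj.1, hw, hj.2.2⟩ hj)
      subst this
      exact hj'.2.1
  · push Not at hfree
    obtain ⟨k, hk, hkn, _, ⟨j, rfl⟩, hkj⟩ := hfree
    have hjJ : j ∉ J := fun hj => hf k hk hkn (a j) ⟨j, hj, rfl⟩ hkj
    have hjm := iter_sub hm hkj hkn.le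
    have w₁ := ih k hkn (similar_self h a h' a' j) hk hkj
      fun k' hk' hk'n => hf k' hk' (hk'n.trans hkn)
    have w₂ := ih (n - k) (by omega) hZ (by omega) hjm fun k' hk' hk'n v hv hv' =>
      hf (k + k') (by omega) (by omega) v hv (iter_trans hkj hv')
    refine w₁.trans ?_ w₂
    rintro ⟨j', hj', hjj'⟩
    exact hjJ (H.inj' hjj' ▸ hj')

theorem reach (H : Sim q α s h a s' h' a') {i : I} {m m' : Loc}
    (hr : h.Reach (a i) m) (hZ : Similar h a h' a' m m') : h'.Reach (a' i) m' := by
  rcases hr.eq_or_walk with rfl | hw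
  · rw [hZ.eq_of_left H.inj]
    exact Reach.refl _ _
  · rw [← Set.image_empty a] at hw
    exact (H.walk ∅ hw hZ).reach

/-- Meet-points transfer. -/
theorem isMeet (H : Sim q α s h a s' h' a') (hα : 1 ≤ α) {x y : Fin q} {l : Loc}
    (hl : IsMeet q s h x y l) : ∃ p, l = a p ∧ IsMeet q s' h' x y (a' p) := by
  classical
  obtain ⟨p, rfl⟩ := isMeet_mem_of_separated H.var_mem_range H.sep hl
  refine ⟨p, rfl, ?_⟩
  obtain ⟨L₁, L₂, ⟨h1, h2⟩, hmin, z, hz⟩ := hl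
  obtain ⟨i, hi, hi'⟩ := H.vars x
  obtain ⟨j, hj, hj'⟩ := H.vars y
  obtain ⟨k, hk, hk'⟩ := H.vars z
  rw [← hi] at h1 hmin
  rw [← hj] at h2 hmin
  rw [← hk] at hz
  unfold IsMeet
  rw [← hi', ← hj']
  have hx : h'.Reach (a' i) (a' p) := H.reach ⟨L₁, h1⟩ (similar_self _ _ _ _ p)
  have hy : h'.Reach (a' j) (a' p) := H.reach ⟨L₂, h2⟩ (similar_self _ _ _ _ p)
  have hz' : h'.Reach (a' p) (a' k) := H.reach hz (similar_self _ _ _ _ k)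
  obtain ⟨M₂, hM₂⟩ := hy
  -- The path may run through `a' p` repeatedly, so the first visit is chosen. No minimality of `M₂`
  -- is needed.
  refine ⟨Nat.find hx, M₂, ⟨Nat.find_spec hx, hM₂⟩, ?_, z, hk' ▸ hz'⟩
  intro M hM M' hMM'
  obtain ⟨c', hc', hcp'⟩ := iter_split (Nat.find_spec hx) hM.le
  have hcy' : h'.Reach (a' j) c' := ⟨M', hMM' ▸ hc'⟩
  have hav : ∀ M' ≤ M, h'.iter M' (a' i) ≠ some (a' p) := fun M' hM' =>
    Nat.find_min hx (hM'.trans_lt hM)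
  -- An earlier common location `c'` lies on a path between markers, so it has a partner `c` in the
  -- original heap. There `c` is reached from both variables, and from the first one without
  -- visiting `a p` on the way, which contradicts `hmin`.
  obtain ⟨c, hZ⟩ := H.symm.exists_similar hα
    (mem_or_segAt (h := h') ⟨i, rfl⟩ ⟨p, rfl⟩ ⟨M, hc'⟩ ⟨_, hcp'⟩)
  have hcp : c ≠ a p := by
    rintro rfl
    rw [hZ.symm.eq_of_left H.inj] at hc'
    exact hav M le_rfl hc'
  obtain ⟨N', hN'⟩ := H.symm.reach hcy' hZ
  have hN : ∃ N, h.iter N (a i) = some c ∧ ∀ k < N, h.iter k (a i) ≠ some (a p) := by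
    rcases Nat.eq_zero_or_pos M with rfl | hpos
    · cases hc'
      rw [hZ.eq_of_left H.inj']
      exact ⟨0, rfl, fun k hk => absurd hk (Nat.not_lt_zero k)⟩
    · have w : h'.Walk (a' '' {p}) (a' i) c' := by
        refine ⟨M, hpos, hc', fun k _ hkM v hv => ?_⟩
        rw [Set.image_singleton, Set.mem_singleton_iff] at hv
        exact hv ▸ hav k hkM.le
      obtain ⟨N, -, hN, hf⟩ := H.symm.walk {p} w hZ
      refine ⟨N, hN, fun k hkN hkp => ?_⟩
      rcases Nat.eq_zero_or_pos k with rfl | hk0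
      · refine hav 0 (Nat.zero_le M) ?_
        rw [H.inj (Option.some.inj hkp)]
        rfl
      · exact hf k hk0 hkN (a p) ⟨p, rfl, rfl⟩ hkp
  obtain ⟨N, hN, hf⟩ := hN
  rcases lt_trichotomy N L₁ with hlt | rfl | hgt
  · exact hmin N hlt N' (hN.trans hN'.symm)
  · exact hcp (Option.some.inj (hN.symm.trans h1))
  · exact hf L₁ hgt h1

theorem denotes (H : Sim q α s h a s' h' a') (hα : 1 ≤ α) {t : MTerm q} {l : Loc}
    (hl : Denotes s h t l) : ∃ p, l = a p ∧ Denotes s' h' t (a' p) := by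
  cases t with
  | var x =>
    obtain ⟨i, hi, hi'⟩ := H.vars x
    exact ⟨i, hl.symm.trans hi.symm, hi'.symm⟩
  | meet x y => exact H.isMeet hα hl

theorem denotes_iff (H : Sim q α s h a s' h' a') (hα : 1 ≤ α) {t : MTerm q} {p : I} :
    Denotes s h t (a p) ↔ Denotes s' h' t (a' p) := by
  constructor
  · intro hl
    obtain ⟨p', hp, hp'⟩ := H.denotes hα hl
    rwa [H.inj hp]
  · intro hl
    obtain ⟨p', hp, hp'⟩ := H.symm.denotes hα hl
    rwa [H.inj' hp]

theorem labels_eq_image (H : Sim q α s h a s' h' a') (hα : 1 ≤ α) :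
    Labels q s h = a '' {p | a p ∈ Labels q s h} := by
  ext l
  constructor
  · rintro ⟨t, ht⟩
    obtain ⟨p, rfl, -⟩ := H.denotes hα ht
    exact ⟨p, ⟨t, ht⟩, rfl⟩
  · rintro ⟨p, hp, rfl⟩
    exact hp

theorem labels_iff (H : Sim q α s h a s' h' a') (hα : 1 ≤ α) (p : I) :
    a p ∈ Labels q s h ↔ a' p ∈ Labels q s' h' :=
  exists_congr fun _ => H.denotes_iff hα

theorem walk_labels (H : Sim q α s h a s' h' a') (hα : 1 ≤ α) {i : I} {m m' : Loc}
    (hw : h.Walk (Labels q s h) (a i) m) (hZ : Similar h a h' a' m m') :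
    h'.Walk (Labels q s' h') (a' i) m' := by
  rw [H.labels_eq_image hα] at hw
  rw [H.symm.labels_eq_image hα]
  simp only [H.labels_iff hα] at hw
  exact H.walk _ hw hZ

theorem edge (H : Sim q α s h a s' h' a') (hα : 1 ≤ α) {p r : I}
    (he : Edge q s h (a p) (a r)) : Edge q s' h' (a' p) (a' r) :=
  ⟨(H.labels_iff hα p).1 he.1, (H.labels_iff hα r).1 he.2.1,
    H.walk_labels hα he.2.2 (similar_self _ _ _ _ r)⟩

theorem labels_subset_range (H : Sim q α s h a s' h' a') (hα : 1 ≤ α) :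
    Labels q s h ⊆ Set.range a := by
  rw [H.labels_eq_image hα]
  exact Set.image_subset_range _ _

theorem not_mem_labels (H : Sim q α s h a s' h' a') (hα : 1 ≤ α) {m m' : Loc}
    (hZ : Similar h a h' a' m m') (hm : m ∉ Labels q s h) : m' ∉ Labels q s' h' := by
  rcases hZ with ⟨i, rfl, rfl⟩ | ⟨i, -, hs⟩
  · exact fun hi => hm ((H.labels_iff hα i).2 hi)
  · exact fun hm' => hs.1 (H.symm.labels_subset_range hα hm')

theorem btw (H : Sim q α s h a s' h' a') (hα : 1 ≤ α) {p r : I}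
    (he : Edge q s h (a p) (a r)) {m m' : Loc} (hZ : Similar h a h' a' m m')
    (hm : m ∈ Btw q s h (a p) (a r)) : m' ∈ Btw q s' h' (a' p) (a' r) := by
  rw [btw_eq_of_edge he] at hm
  rw [btw_eq_of_edge (H.edge hα he)]
  exact ⟨H.not_mem_labels hα hZ hm.1, H.walk_labels hα hm.2 hZ⟩

theorem btw_subset_dom (q : ℕ) (s : Store) (h : Heap) (l l' : Loc) : Btw q s h l l' ⊆ h.dom := by
  rintro m ⟨L, L', -, hL', -, hm, -⟩
  exact h.mem_dom_of_iter hL' hm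

theorem not_mem_btw_of_rest (H : Sim q α s h a s' h' a') (hα : 1 ≤ α) {m l l' : Loc}
    (hm : m ∈ Cell h a (.inr none)) (he : Edge q s h l l') : m ∉ Btw q s h l l' := by
  rintro ⟨L, L', -, -, hL, hL', -⟩
  rcases mem_or_segAt (H.labels_subset_range hα he.1) (H.labels_subset_range hα he.2.1)
    ⟨L, hL⟩ ⟨L', hL'⟩ with h1 | ⟨_, ⟨i, rfl⟩, hi⟩
  · exact hm.2.1 h1
  · exact hm.2.2 i hi

theorem similar_or_rest {c : I ⊕ Option I} {m m' : Loc} (hm : m ∈ Cell h a c)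
    (hm' : m' ∈ Cell h' a' c) : Similar h a h' a' m m' ∨
      m ∈ Cell h a (.inr none) ∧ m' ∈ Cell h' a' (.inr none) := by
  rcases c with i | _ | i
  · exact .inl (.inl ⟨i, hm.1, hm'.1⟩)
  · exact .inr ⟨hm, hm'⟩
  · exact .inl (.inr ⟨i, hm, hm'⟩)

/-- Cells of the rest have no partner under `Similar`, so they need the separate condition `hrest`:
all of them are treated alike. -/
theorem min_ncard_eq [Finite I] (H : Sim q α s h a s' h' a') (hα : 1 ≤ α) {S S' : Set Loc}
    (hS : S ⊆ h.dom) (hS' : S' ⊆ h'.dom)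
    (hsat : ∀ m m', Similar h a h' a' m m' → (m ∈ S ↔ m' ∈ S'))
    (hrest : ∀ m ∈ Cell h a (.inr none), ∀ m' ∈ Cell h' a' (.inr none), (m ∈ S ↔ m' ∈ S')) :
    min α S.ncard = min α S'.ncard := by
  refine min_ncard_eq_of_classes hα (finite_cell h a) (finite_cell h' a')
    (pairwise_disjoint_cell H.inj H.sep) (pairwise_disjoint_cell H.inj' H.sep') H.card
    (hS.trans (dom_subset_iUnion_cell h a)) (hS'.trans (dom_subset_iUnion_cell h' a')) ?_
  intro c m hm m' hm'
  rcases similar_or_rest hm hm' with hZ | ⟨h1, h2⟩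
  · exact hsat m m' hZ
  · exact hrest m h1 m' h2

theorem min_ncard_btw [Finite I] (H : Sim q α s h a s' h' a') (hα : 1 ≤ α) {p r : I}
    (he : Edge q s h (a p) (a r)) :
    min α (Btw q s h (a p) (a r)).ncard = min α (Btw q s' h' (a' p) (a' r)).ncard :=
  H.min_ncard_eq hα (btw_subset_dom _ _ _ _ _) (btw_subset_dom _ _ _ _ _)
    (fun _ _ hZ => ⟨H.btw hα he hZ, H.symm.btw hα (H.edge hα he) hZ.symm⟩)
    fun _ hm _ hm' => ⟨fun hb => absurd hb (H.not_mem_btw_of_rest hα hm he),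
      fun hb => absurd hb (H.symm.not_mem_btw_of_rest hα hm' (H.edge hα he))⟩

theorem mem_rem_iff {q : ℕ} {s : Store} {h : Heap} {m : Loc} :
    m ∈ Rem q s h ↔
      m ∈ h.dom ∧ m ∉ Labels q s h ∧ ∀ l l', Edge q s h l l' → m ∉ Btw q s h l l' := by
  simp only [Rem, AllocSet, Set.mem_sdiff, Set.mem_union, Set.mem_inter_iff, Set.mem_ofPred_eq,
    not_or, not_exists, not_and]
  tauto

theorem rest_subset_rem (H : Sim q α s h a s' h' a') (hα : 1 ≤ α) :
    Cell h a (.inr none) ⊆ Rem q s h := fun _ hm =>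
  mem_rem_iff.2 ⟨hm.1, fun hl => hm.2.1 (H.labels_subset_range hα hl),
    fun _ _ he => H.not_mem_btw_of_rest hα hm he⟩

theorem similar_mem_dom (H : Sim q α s h a s' h' a') (hα : 1 ≤ α) {m m' : Loc}
    (hZ : Similar h a h' a' m m') (hm : m ∈ h.dom) : m' ∈ h'.dom := by
  rcases hZ with ⟨i, rfl, rfl⟩ | ⟨i, -, hs⟩
  · exact H.mem_dom hα hm
  · exact hs.mem_dom

theorem mem_rem (H : Sim q α s h a s' h' a') (hα : 1 ≤ α) {m m' : Loc}
    (hZ : Similar h a h' a' m m') (hm : m ∈ Rem q s h) : m' ∈ Rem q s' h' := by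
  rw [mem_rem_iff] at hm ⊢
  refine ⟨H.similar_mem_dom hα hZ hm.1, H.not_mem_labels hα hZ hm.2.1, fun l l' he hb => ?_⟩
  obtain ⟨p, rfl⟩ := H.symm.labels_subset_range hα he.1
  obtain ⟨r, rfl⟩ := H.symm.labels_subset_range hα he.2.1
  exact hm.2.2 _ _ (H.symm.edge hα he) (H.symm.btw hα he hZ.symm hb)

theorem min_ncard_rem [Finite I] (H : Sim q α s h a s' h' a') (hα : 1 ≤ α) :
    min α (Rem q s h).ncard = min α (Rem q s' h').ncard :=
  H.min_ncard_eq hα Set.sdiff_subset Set.sdiff_subset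
    (fun _ _ hZ => ⟨H.mem_rem hα hZ, H.symm.mem_rem hα hZ.symm⟩)
    fun _ hm _ hm' => ⟨fun _ => H.symm.rest_subset_rem hα hm', fun _ => H.rest_subset_rem hα hm⟩

theorem sat [Finite I] (H : Sim q α s h a s' h' a') (hα : 1 ≤ α) {ψ : TestFormula q}
    (hψ : ψ ∈ Test q α) (hs : ψ.Sat s h) : ψ.Sat s' h' := by
  cases ψ with
  | eq t t' =>
    obtain ⟨l, h1, h2⟩ := hs
    obtain ⟨p, rfl, hp⟩ := H.denotes hα h1
    exact ⟨a' p, hp, (H.denotes_iff hα).1 h2⟩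
  | alloc t =>
    obtain ⟨l, ⟨hl, hd⟩, ht⟩ := hs
    obtain ⟨p, rfl, hp⟩ := H.denotes hα ht
    exact ⟨a' p, ⟨(H.labels_iff hα p).1 hl, H.mem_dom hα hd⟩, hp⟩
  | pto t t' =>
    obtain ⟨l, l', he, h1, h2, hc⟩ := hs
    obtain ⟨p, rfl, hp⟩ := H.denotes hα h1
    obtain ⟨r, rfl, hr⟩ := H.denotes hα h2
    refine ⟨a' p, a' r, H.edge hα he, hp, hr, ?_⟩
    have := H.min_ncard_btw hα he
    omega
  | sees t t' β =>
    obtain ⟨l, l', he, h1, h2, hc⟩ := hs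
    obtain ⟨p, rfl, hp⟩ := H.denotes hα h1
    obtain ⟨r, rfl, hr⟩ := H.denotes hα h2
    refine ⟨a' p, a' r, H.edge hα he, hp, hr, ?_⟩
    have := H.min_ncard_btw hα he
    have : 1 ≤ β ∧ β ≤ α := hψ
    omega
  | sizeR β =>
    have := H.min_ncard_rem hα
    have : 1 ≤ β ∧ β ≤ α := hψ
    have : β ≤ (Rem q s h).ncard := hs
    show β ≤ (Rem q s' h').ncard
    omega

theorem indist [Finite I] (H : Sim q α s h a s' h' a') (hα : 1 ≤ α) : Indist q α s h s' h' :=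
  fun _ hψ => ⟨H.sat hα hψ, H.symm.sat hα hψ⟩

end Sim

/-! ### The labels separate the segments between them. -/

theorem reach_var_of_mem_labels {q : ℕ} {s : Store} {h : Heap} {l : Loc}
    (hl : l ∈ Labels q s h) :
    (∃ x : Fin q, h.Reach (s x) l) ∧ ∃ x : Fin q, h.Reach l (s x) := by
  obtain ⟨t, ht⟩ := hl
  cases t with
  | var x =>
    cases ht
    exact ⟨⟨x, Reach.refl _ _⟩, x, Reach.refl _ _⟩
  | meet x y =>
    obtain ⟨L, -, ⟨hL, -⟩, -, z, M, hM⟩ := ht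
    exact ⟨⟨x, L, hL⟩, z, M, hM⟩

theorem var_mem_labels {q : ℕ} (s : Store) (h : Heap) (x : Fin q) : s x ∈ Labels q s h :=
  ⟨.var x, rfl⟩

/-- A variable that reaches a location strictly between labels reaches the last label before it. -/
theorem reach_label_of_walk {q : ℕ} {s : Store} {h : Heap} {u m : Loc} {y z : Fin q}
    (hu : u ∈ Labels q s h) (hm : m ∉ Labels q s h) (hw : h.Walk (Labels q s h) u m)
    (hz : h.Reach m (s z)) (hy : h.Reach (s y) m) : h.Reach (s y) u := by
  classical
  obtain ⟨⟨x, N, hN⟩, -⟩ := reach_var_of_mem_labels hu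
  obtain ⟨n, hn, hum, hf⟩ := hw
  -- On the path from `x` through `u` to `m`, the first location that `y` also reaches is a
  -- meet-point, as it reaches `z` through `m`. Being labelled, it can lie neither strictly between
  -- `u` and `m` nor at `m`, so it comes no later than `u`.
  have hex : ∃ k, ∃ v, h.iter k (s x) = some v ∧ h.Reach (s y) v :=
    ⟨N + n, m, iter_trans hN hum, hy⟩
  obtain ⟨p, hp, M, hM⟩ := Nat.find_spec hex
  have hle : Nat.find hex ≤ N + n := Nat.find_min' hex ⟨m, iter_trans hN hum, hy⟩
  have hpm := iter_sub (iter_trans hN hum) hp hle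
  have hpL : p ∈ Labels q s h := by
    obtain ⟨t, ht⟩ := Reach.trans ⟨_, hpm⟩ hz
    refine ⟨.meet x y, _, M, ⟨hp, hM⟩, fun k hk k' hkk' => ?_, z, t, ht⟩
    obtain ⟨v, hv, -⟩ := iter_split hp hk.le
    exact Nat.find_min hex hk ⟨v, hv, k', hkk' ▸ hv⟩
  rcases le_or_gt (Nat.find hex) N with hlt | hgt
  · exact Reach.trans ⟨M, hM⟩ ⟨_, iter_sub hN hp hlt⟩
  · have hup := iter_sub hp hN hgt.le
    rcases hle.lt_or_eq with h1 | h1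
    · exact absurd hup (hf _ (by omega) (by omega) p hpL)
    · rw [h1, Nat.add_sub_cancel_left, hum] at hup
      cases hup
      exact absurd hpL hm

theorem reach_symm_of_periodic {h : Heap} {p : ℕ} {m v : Loc} (hp : 1 ≤ p)
    (hm : h.iter p m = some m) (hv : h.Reach m v) : h.Reach v m := by
  obtain ⟨t, ht⟩ := hv
  exact ⟨t * p - t, iter_sub (iter_mul hm t) ht (Nat.le_mul_of_pos_right _ hp)⟩

theorem iter_periodic {h : Heap} {p d : ℕ} {u v : Loc} (hu : h.iter p u = some u)
    (hv : h.iter d u = some v) : h.iter p v = some v := by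
  have h1 := iter_trans hu hv
  rw [Nat.add_comm] at h1
  have h2 := iter_sub h1 hv (Nat.le_add_right d p)
  rwa [Nat.add_sub_cancel_left] at h2

/-- On a cycle, the last predecessor in `A` is unique. -/
theorem eq_of_walk_of_cycle {h : Heap} {A : Set Loc} {u v m : Loc} (hu : u ∈ A) (hv : v ∈ A)
    (hum : h.Walk A u m) (hvm : h.Walk A v m) (hmu : h.Reach m u) (hmv : h.Reach m v) :
    u = v := by
  obtain ⟨a, ha, hua, hfa⟩ := hum
  obtain ⟨b, hb, hvb, hfb⟩ := hvm
  obtain ⟨c, hc⟩ := hmu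
  obtain ⟨d, hd⟩ := hmv
  wlog hab : a ≤ b generalizing u v a b c d
  · exact (this hv hu b hb hvb hfb a ha hua hfa d hd c hc (by omega)).symm
  -- The location `w` on the longer walk is as far from `m` as `u` is. Both lie on the cycle, where
  -- iteration is injective, so `u = w`, and `u ∈ A` forces `w` to be the start of that walk.
  obtain ⟨w, hw, hwm⟩ := iter_split hvb (Nat.sub_le b a)
  rw [Nat.sub_sub_self hab] at hwm
  have huw : u = w := iter_inj_of_periodic (by omega) (by omega) (iter_trans hua hc)
    (iter_periodic (iter_trans hvb hd) hw) hua hwm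
  subst huw
  rcases hab.lt_or_eq with hlt | rfl
  · exact absurd hw (hfb _ (by omega) (by omega) u hu)
  · rw [Nat.sub_self] at hw
    exact (Option.some.inj hw).symm

/-- Two paths that merge before reaching a variable merge at a meet-point, which is labelled; so a
variable leading to `u₂`, and thus to `m`, also passes through `u₁`. Both labels are then on one
path. If the later one comes before `m`, it would interrupt the walk from the earlier one; if it
comes after `m`, then `m` lies on a cycle, where the last label before it is unique. -/
theorem separated_labels (q : ℕ) (s : Store) (h : Heap) : h.Separated (Labels q s h) := by
  intro u₁ hu₁ u₂ hu₂ m hs₁ hs₂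
  obtain ⟨hm, hw₁, w, hw, hmw⟩ := hs₁
  obtain ⟨-, hw₂, -⟩ := hs₂
  obtain ⟨-, z, hz⟩ := reach_var_of_mem_labels hw
  have hmz := hmw.trans hz
  have key : ∀ {u v}, u ∈ Labels q s h → v ∈ Labels q s h → h.Walk (Labels q s h) u m →
      h.Walk (Labels q s h) v m → h.Reach u v → u = v := by
    intro u v hu hv hum hvm huv
    obtain ⟨k, hk⟩ := huv
    obtain ⟨a, ha, hua, hfa⟩ := id hum
    rcases Nat.eq_zero_or_pos k with rfl | hk0
    · exact Option.some.inj hk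
    rcases lt_trichotomy k a with hlt | rfl | hgt
    · exact absurd hk (hfa k hk0 hlt v hv)
    · rw [hua] at hk
      cases hk
      exact absurd hv hm
    have hmv := iter_sub hk hua hgt.le
    obtain ⟨b, hb, hvb, -⟩ := id hvm
    have hmm := iter_trans hmv hvb
    -- The variable `z` reached from `m` lies on the cycle of `m`, hence leads back to `m` and so to
    -- `u`. This puts `u` on the cycle as well.
    have hzm := reach_symm_of_periodic (by omega) hmm hmz
    exact eq_of_walk_of_cycle hu hv hum hvm
      (hmz.trans (reach_label_of_walk hu hm hum hmz hzm)) ⟨_, hmv⟩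
  obtain ⟨⟨x, N₂, hN₂⟩, -⟩ := reach_var_of_mem_labels hu₂
  obtain ⟨N₁, hN₁⟩ := reach_label_of_walk hu₁ hm hw₁ hmz (Reach.trans ⟨N₂, hN₂⟩ hw₂.reach)
  rcases le_total N₁ N₂ with hle | hle
  · exact key hu₁ hu₂ hw₁ hw₂ ⟨_, iter_sub hN₂ hN₁ hle⟩
  · exact (key hu₂ hu₁ hw₂ hw₁ ⟨_, iter_sub hN₁ hN₂ hle⟩).symm

/-! ### Labels as markers: from indistinguishability to similarity. -/

instance (q : ℕ) : Finite (MTerm q) :=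
  Finite.of_injective (β := Fin q ⊕ Fin q × Fin q)
    (fun t => match t with | .var i => .inl i | .meet i j => .inr (i, j)) (by
      rintro (i | ⟨i, j⟩) (i' | ⟨i', j'⟩) hij <;> simp_all)

theorem finite_labels (q : ℕ) (s : Store) (h : Heap) : (Labels q s h).Finite := by
  have : ∀ t : MTerm q, {l | Denotes s h t l}.Finite := fun t =>
    Set.Subsingleton.finite fun _ hl _ hl' => hl.unique hl'
  refine (Set.finite_iUnion this).subset ?_
  rintro l ⟨t, ht⟩
  exact Set.mem_iUnion.2 ⟨t, ht⟩

theorem setOf_segAt_labels_eq_btw {q : ℕ} {s : Store} {h : Heap} {l l' : Loc}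
    (he : Edge q s h l l') : {m | h.SegAt (Labels q s h) l m} = Btw q s h l l' := by
  rw [btw_eq_of_edge he]
  ext m
  exact ⟨fun hm => ⟨hm.1, hm.2.1⟩, fun hm =>
    ⟨hm.1, hm.2, l', he.2.1, (hm.2.remainder hm.1 he.2.1 he.2.2).reach⟩⟩

theorem cell_rest_eq_rem {I : Type} {q : ℕ} {s : Store} {h : Heap} {a : I → Loc}
    (ha : Set.range a = Labels q s h) : Cell h a (.inr none) = Rem q s h := by
  ext m
  rw [Sim.mem_rem_iff]
  simp only [Cell, ha, Set.mem_ofPred_eq]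
  refine and_congr_right fun _ => and_congr_right fun _ => ⟨fun hm l l' he hb => ?_,
    fun hm i hi => ?_⟩
  · obtain ⟨i, rfl⟩ : l ∈ Set.range a := ha ▸ he.1
    rw [← setOf_segAt_labels_eq_btw he] at hb
    exact hm i hb
  · obtain ⟨v, hv, hw, -⟩ := hi.walk
    have he : Edge q s h (a i) v := ⟨ha ▸ ⟨i, rfl⟩, hv, hw⟩
    have := hm _ _ he
    rw [← setOf_segAt_labels_eq_btw he] at this
    exact this hi

theorem min_eq_of_forall_le_iff {α n n' : ℕ} (hn : ∀ β, 1 ≤ β → β ≤ α → (β ≤ n ↔ β ≤ n')) :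
    min α n = min α n' := by
  have h1 := hn (min α n)
  have h2 := hn (min α n')
  omega

theorem min_ncard_cell_inl {I : Type} {α : ℕ} {h h' : Heap} {a a' : I → Loc} {i : I}
    (hi : a i ∈ h.dom ↔ a' i ∈ h'.dom) :
    min α (Cell h a (.inl i)).ncard = min α (Cell h' a' (.inl i)).ncard := by
  have mem : ∀ {g : Heap} {b : I → Loc}, b i ∈ g.dom → Cell g b (.inl i) = {b i} := by
    intro g b hb
    ext m
    exact ⟨fun hm => hm.1, fun hm => ⟨hm, (show m = b i from hm) ▸ hb⟩⟩
  have notMem : ∀ {g : Heap} {b : I → Loc}, b i ∉ g.dom → Cell g b (.inl i) = ∅ :=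
    fun hb => Set.eq_empty_of_forall_notMem fun m hm => hb (hm.1 ▸ hm.2)
  by_cases hd : a i ∈ h.dom
  · rw [mem hd, mem (hi.1 hd), Set.ncard_singleton, Set.ncard_singleton]
  · rw [notMem hd, notMem fun hd' => hd (hi.2 hd')]

/-- Indistinguishable memory states are similar with respect to their labels. -/
theorem Indist.exists_sim {q α : ℕ} {s s' : Store} {h h' : Heap} (hα : 1 ≤ α)
    (H : Indist q α s h s' h') :
    ∃ a' : Labels q s h → Loc, Sim q α s h Subtype.val s' h' a' := by
  have hex : ∀ p : Labels q s h, ∃ l', ∃ t : MTerm q, Denotes s h t p ∧ Denotes s' h' t l' := by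
    rintro ⟨l, t, ht⟩
    obtain ⟨l', hl', -⟩ := (H (.eq t t) trivial).1 ⟨l, ht, ht⟩
    exact ⟨l', t, ht, hl'⟩
  choose a' ha' using hex
  have hden : ∀ (p : Labels q s h) (t : MTerm q), Denotes s h t p ↔ Denotes s' h' t (a' p) := by
    intro p t
    obtain ⟨t₀, h0, h0'⟩ := ha' p
    constructor
    · intro ht
      obtain ⟨l', h1, h2⟩ := (H (.eq t₀ t) trivial).1 ⟨p, h0, ht⟩
      rwa [h0'.unique h1]
    · intro ht
      obtain ⟨l', h1, h2⟩ := (H (.eq t₀ t) trivial).2 ⟨a' p, h0', ht⟩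
      rwa [h0.unique h1]
  have hran : Set.range (Subtype.val : Labels q s h → Loc) = Labels q s h := Subtype.range_val
  have hran' : Set.range a' = Labels q s' h' := by
    ext l'
    constructor
    · rintro ⟨p, rfl⟩
      obtain ⟨t, -, ht⟩ := ha' p
      exact ⟨t, ht⟩
    · rintro ⟨t, ht⟩
      obtain ⟨l, hl, -⟩ := (H (.eq t t) trivial).2 ⟨l', ht, ht⟩
      exact ⟨⟨l, t, hl⟩, ((hden ⟨l, t, hl⟩ t).1 hl).unique ht⟩
  have hmem' : ∀ p, a' p ∈ Labels q s' h' := fun p => hran' ▸ ⟨p, rfl⟩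
  have hedge : ∀ p r : Labels q s h, Edge q s h p r ↔ Edge q s' h' (a' p) (a' r) := by
    intro p r
    obtain ⟨t, ht, ht'⟩ := ha' p
    obtain ⟨u, hu, hu'⟩ := ha' r
    constructor
    · intro he
      -- No single test formula expresses an edge, but `pto` covers the edges with nothing in
      -- between and `sees` with `β = 1` covers the others; the latter is available because `1 ≤ α`.
      have : ∃ l l', Edge q s' h' l l' ∧ Denotes s' h' t l ∧ Denotes s' h' u l' := by
        rcases Nat.eq_zero_or_pos (Btw q s h p r).ncard with h0 | h1
        · obtain ⟨l, l', h1, h2, h3, -⟩ :=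
            (H (.pto t u) trivial).1 ⟨p, r, he, ht, hu, h0⟩
          exact ⟨l, l', h1, h2, h3⟩
        · obtain ⟨l, l', h1, h2, h3, -⟩ :=
            (H (.sees t u 1) ⟨le_rfl, hα⟩).1 ⟨p, r, he, ht, hu, h1⟩
          exact ⟨l, l', h1, h2, h3⟩
      obtain ⟨l, l', h1, h2, h3⟩ := this
      rwa [ht'.unique h2, hu'.unique h3]
    · intro he
      have : ∃ l l', Edge q s h l l' ∧ Denotes s h t l ∧ Denotes s h u l' := by
        rcases Nat.eq_zero_or_pos (Btw q s' h' (a' p) (a' r)).ncard with h0 | h1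
        · obtain ⟨l, l', h1, h2, h3, -⟩ :=
            (H (.pto t u) trivial).2 ⟨a' p, a' r, he, ht', hu', h0⟩
          exact ⟨l, l', h1, h2, h3⟩
        · obtain ⟨l, l', h1, h2, h3, -⟩ :=
            (H (.sees t u 1) ⟨le_rfl, hα⟩).2 ⟨a' p, a' r, he, ht', hu', h1⟩
          exact ⟨l, l', h1, h2, h3⟩
      obtain ⟨l, l', h1, h2, h3⟩ := this
      rwa [ht.unique h2, hu.unique h3]
  have hbtw : ∀ p r : Labels q s h, Edge q s h p r →
      min α (Btw q s h p r).ncard = min α (Btw q s' h' (a' p) (a' r)).ncard := by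
    intro p r he
    obtain ⟨t, ht, ht'⟩ := ha' p
    obtain ⟨u, hu, hu'⟩ := ha' r
    refine min_eq_of_forall_le_iff fun β h1 h2 => ⟨fun hβ => ?_, fun hβ => ?_⟩
    · obtain ⟨l, l', -, h3, h4, h5⟩ :=
        (H (.sees t u β) ⟨h1, h2⟩).1 ⟨p, r, he, ht, hu, hβ⟩
      rwa [ht'.unique h3, hu'.unique h4]
    · obtain ⟨l, l', -, h3, h4, h5⟩ :=
        (H (.sees t u β) ⟨h1, h2⟩).2 ⟨a' p, a' r, (hedge p r).1 he, ht', hu', hβ⟩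
      rwa [ht.unique h3, hu.unique h4]
  have hdom : ∀ p : Labels q s h, p.1 ∈ h.dom ↔ a' p ∈ h'.dom := by
    intro p
    obtain ⟨t, ht, ht'⟩ := ha' p
    constructor
    · intro hd
      obtain ⟨l, ⟨-, h1⟩, h2⟩ := (H (.alloc t) trivial).1 ⟨p, ⟨p.2, hd⟩, ht⟩
      rwa [ht'.unique h2]
    · intro hd
      obtain ⟨l, ⟨-, h1⟩, h2⟩ := (H (.alloc t) trivial).2 ⟨a' p, ⟨hmem' p, hd⟩, ht'⟩
      rwa [ht.unique h2]
  refine ⟨a', Subtype.val_injective, ?_, ?_, ?_, ?_, ?_, ?_⟩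
  · intro p r hpr
    obtain ⟨t, ht, ht'⟩ := ha' p
    exact Subtype.ext (ht.unique ((hden r t).2 (hpr ▸ ht')))
  · intro x
    have hx : Denotes s h (.var x) (s x) := rfl
    exact ⟨⟨s x, var_mem_labels s h x⟩, rfl, ((hden ⟨s x, var_mem_labels s h x⟩ _).1 hx).symm⟩
  · rw [hran]
    exact separated_labels q s h
  · rw [hran']
    exact separated_labels q s' h'
  · intro p r
    rw [hran, hran']
    exact ⟨fun hw => ((hedge p r).1 ⟨p.2, r.2, hw⟩).2.2,
      fun hw => ((hedge p r).2 ⟨hmem' p, hmem' r, hw⟩).2.2⟩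
  · rintro (p | _ | p)
    · exact min_ncard_cell_inl (hdom p)
    · rw [cell_rest_eq_rem hran, cell_rest_eq_rem hran']
      exact min_eq_of_forall_le_iff fun β h1 h2 => H (.sizeR β) ⟨h1, h2⟩
    · simp only [Cell, hran, hran']
      by_cases hr : ∃ r : Labels q s h, Edge q s h p r
      · obtain ⟨r, hr⟩ := hr
        rw [setOf_segAt_labels_eq_btw hr, setOf_segAt_labels_eq_btw ((hedge p r).1 hr),
          hbtw p r hr]
      -- A nonempty segment always ends at a label, so a label without an outgoing edge has an empty
      -- segment, in both states.
      · have h1 : {m | h.SegAt (Labels q s h) p m} = ∅ :=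
          Set.eq_empty_of_forall_notMem fun m hm => by
            obtain ⟨v, hv, hw, -⟩ := hm.walk
            exact hr ⟨⟨v, hv⟩, p.2, hv, hw⟩
        have h2 : {m | h'.SegAt (Labels q s' h') (a' p) m} = ∅ :=
          Set.eq_empty_of_forall_notMem fun m hm => by
            obtain ⟨v, hv, hw, -⟩ := hm.walk
            obtain ⟨r, rfl⟩ : v ∈ Set.range a' := hran' ▸ hv
            exact hr ⟨r, (hedge p r).2 ⟨hmem' p, hv, hw⟩⟩
        rw [h1, h2]

/-! ### Heap splittings as restrictions. -/

namespace Heap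

open Classical in
/-- The restriction of a heap to a set of locations. -/
noncomputable def restrict (h : Heap) (D : Set Loc) : Heap where
  val l := if l ∈ D then h.val l else none
  finite_dom' := by
    refine h.finite_dom.subset fun l hl => ?_
    by_cases hD : l ∈ D
    · simpa [hD, dom] using hl
    · simp [hD] at hl

theorem ext_val {h h' : Heap} (hv : ∀ l, h.val l = h'.val l) : h = h' := by
  cases h
  cases h'
  congr
  exact funext hv

theorem mem_dom_restrict {h : Heap} {D : Set Loc} {l : Loc} :
    l ∈ (h.restrict D).dom ↔ l ∈ h.dom ∧ l ∈ D := by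
  by_cases hD : l ∈ D <;> simp [restrict, dom, hD]

theorem restrict_val_of_mem {h : Heap} {D : Set Loc} {l : Loc} (hl : l ∈ D) :
    (h.restrict D).val l = h.val l := if_pos hl

theorem val_of_restrict_val {h : Heap} {D : Set Loc} {l v : Loc}
    (hl : (h.restrict D).val l = some v) : h.val l = some v := by
  by_cases hD : l ∈ D
  · rwa [restrict_val_of_mem hD] at hl
  · simp [restrict, hD] at hl

theorem perp_restrict (h : Heap) (D : Set Loc) : (h.restrict D).Perp (h.restrict Dᶜ) := by
  refine Set.eq_empty_of_forall_notMem ?_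
  rintro l ⟨h1, h2⟩
  exact (mem_dom_restrict.1 h2).2 (mem_dom_restrict.1 h1).2

theorem restrict_add_restrict (h : Heap) (D : Set Loc) :
    (h.restrict D).add (h.restrict Dᶜ) = h := by
  refine ext_val fun l => ?_
  by_cases hD : l ∈ D <;> simp [add, restrict, hD]

theorem eq_restrict_of_add {h₁ h₂ : Heap} (hp : h₁.Perp h₂) :
    h₁ = (h₁.add h₂).restrict h₁.dom ∧ h₂ = (h₁.add h₂).restrict h₁.domᶜ := by
  constructor <;> refine ext_val fun l => ?_ <;> by_cases hl : l ∈ h₁.dom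
  · obtain ⟨v, hv⟩ := Option.isSome_iff_exists.1 hl
    simp [restrict, hl, add, hv]
  · have : h₁.val l = none := by simpa [dom] using hl
    simp [restrict, hl, this]
  · have : l ∉ h₂.dom := fun h2 => Set.notMem_empty l (hp ▸ ⟨hl, h2⟩)
    have : h₂.val l = none := by simpa [dom] using this
    simp [restrict, hl, this]
  · have : h₁.val l = none := by simpa [dom] using hl
    simp [restrict, hl, add, this]

theorem iter_of_restrict {h : Heap} {D : Set Loc} {n : ℕ} {u m : Loc}
    (hm : (h.restrict D).iter n u = some m) : h.iter n u = some m := by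
  induction n generalizing m with
  | zero => exact hm
  | succ n ih =>
    obtain ⟨p, hp, hpm⟩ := Option.bind_eq_some_iff.1 hm
    exact Option.bind_eq_some_iff.2 ⟨p, ih hp, val_of_restrict_val hpm⟩

theorem Reach.of_restrict {h : Heap} {D : Set Loc} {u m : Loc}
    (hr : (h.restrict D).Reach u m) : h.Reach u m :=
  hr.imp fun _ => iter_of_restrict

theorem Walk.of_restrict {h : Heap} {D A : Set Loc} {u m : Loc}
    (hw : (h.restrict D).Walk A u m) : h.Walk A u m := by
  obtain ⟨n, hn, hm, hf⟩ := hw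
  refine ⟨n, hn, iter_of_restrict hm, fun k hk hkn v hv hkv => ?_⟩
  obtain ⟨w, hw, -⟩ := iter_split hm hkn.le
  have := iter_of_restrict hw
  rw [hkv] at this
  cases this
  exact hf k hk hkn v hv hw

theorem SegAt.of_restrict {h : Heap} {D A : Set Loc} {u m : Loc}
    (hs : (h.restrict D).SegAt A u m) : h.SegAt A u m := by
  obtain ⟨hm, hw, w, hwA, hr⟩ := hs
  exact ⟨hm, hw.of_restrict, w, hwA, hr.of_restrict⟩

theorem Separated.restrict {h : Heap} {A : Set Loc} (hs : h.Separated A) (D : Set Loc) :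
    (h.restrict D).Separated A :=
  fun u₁ h₁ u₂ h₂ m hm₁ hm₂ => hs u₁ h₁ u₂ h₂ m hm₁.of_restrict hm₂.of_restrict

/-- A location on a walk that survives in a restriction lies on the restricted walk. -/
theorem Walk.restrict_through {h : Heap} {D A : Set Loc} {u m v : Loc}
    (hw : (h.restrict D).Walk A u v) (hv : v ∈ A) (hm : m ∉ A) (hum : h.Walk A u m) :
    (h.restrict D).Walk A u m ∧ (h.restrict D).Walk A m v := by
  have hwm : (h.restrict D).Walk A u m := by
    obtain ⟨n, hn, hnv, -⟩ := hw
    obtain ⟨j, hj, hjm, hf⟩ := hum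
    -- Otherwise the walk to `m` would pass through `v ∈ A` before its end.
    have hle : j ≤ n := by
      by_contra hlt
      exact hf n hn (not_le.1 hlt) v hv (iter_of_restrict hnv)
    obtain ⟨m', hm', -⟩ := iter_split hnv hle
    have := iter_of_restrict hm'
    rw [hjm] at this
    cases this
    exact ⟨j, hj, hm', fun k hk hkj x hx hkx => hf k hk hkj x hx (iter_of_restrict hkx)⟩
  exact ⟨hwm, hwm.remainder hm hv hw⟩

/-- A walk between consecutive markers dereferences exactly its source and the cells of its segment,
so these are the cells that must be kept. -/
theorem walk_restrict_iff {h : Heap} {D A : Set Loc} {u v : Loc} (hv : v ∈ A) :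
    (h.restrict D).Walk A u v ↔
      h.Walk A u v ∧ u ∈ D ∧ ∀ m, h.SegAt A u m → m ∈ D := by
  constructor
  · intro hw
    refine ⟨hw.of_restrict, (mem_dom_restrict.1 hw.mem_dom).2, fun m hm => ?_⟩
    exact (mem_dom_restrict.1 (hw.restrict_through hv hm.1 hm.2.1).2.mem_dom).2
  · rintro ⟨⟨n, hn, hnv, hf⟩, hu, hD⟩
    have hiter : ∀ k ≤ n, ∀ w, h.iter k u = some w → (h.restrict D).iter k u = some w := by
      intro k
      induction k with
      | zero => exact fun _ w hw => hw
      | succ k ih =>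
        intro hk w hw
        obtain ⟨p, hp, hpw⟩ := Option.bind_eq_some_iff.1 hw
        refine Option.bind_eq_some_iff.2 ⟨p, ih (by omega) p hp, ?_⟩
        rw [restrict_val_of_mem, hpw]
        rcases Nat.eq_zero_or_pos k with rfl | hk0
        · cases hp
          exact hu
        · refine hD p ⟨fun hpA => hf k hk0 hk p hpA hp, ⟨k, hk0, hp, fun j hj hjk =>
            hf j hj (by omega)⟩, v, hv, _, iter_sub hnv hp (by omega)⟩
    exact ⟨n, hn, hiter n le_rfl v hnv, fun k hk hkn x hx hkx =>
      hf k hk hkn x hx (iter_of_restrict hkx)⟩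

theorem segAt_restrict_iff {h : Heap} {D A : Set Loc} {u m : Loc} :
    (h.restrict D).SegAt A u m ↔ h.SegAt A u m ∧ ∃ v ∈ A, (h.restrict D).Walk A u v := by
  constructor
  · intro hs
    obtain ⟨v, hv, hw, -⟩ := hs.walk
    exact ⟨hs.of_restrict, v, hv, hw⟩
  · rintro ⟨hs, v, hv, hw⟩
    obtain ⟨h1, h2⟩ := hw.restrict_through hv hs.1 hs.2.1
    exact ⟨hs.1, h1, v, hv, h2.reach⟩

end Heap

section Cells

variable {I : Type} {h : Heap} {a : I → Loc} {D : Set Loc}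

/-- In this form, survival depends only on whether certain parts of classes are empty, which any
threshold at least 1 detects. -/
theorem walk_restrict_iff_cell {i j : I} :
    (h.restrict D).Walk (Set.range a) (a i) (a j) ↔
      h.Walk (Set.range a) (a i) (a j) ∧ (Cell h a (.inl i) ∩ D).Nonempty ∧
        Cell h a (.inr (some i)) ∩ Dᶜ = ∅ := by
  rw [walk_restrict_iff (Set.mem_range_self j)]
  refine and_congr_right fun hw => and_congr ⟨fun hi => ⟨a i, ⟨rfl, hw.mem_dom⟩, hi⟩, ?_⟩ ?_
  · rintro ⟨m, ⟨rfl, -⟩, hi⟩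
    exact hi
  · rw [← Set.sdiff_eq, Set.sdiff_eq_empty]
    rfl

theorem mem_cell_iff_eq (ha : Function.Injective a) (hsep : h.Separated (Set.range a))
    {c d : I ⊕ Option I} {m : Loc} (hm : m ∈ Cell h a c) : m ∈ Cell h a d ↔ c = d := by
  constructor
  · intro hd
    by_contra hcd
    exact Set.disjoint_left.1 (pairwise_disjoint_cell ha hsep hcd) hm hd
  · rintro rfl
    exact hm

theorem mem_cell_restrict_inl {m : Loc} (hm : m ∈ D) (i : I) :
    m ∈ Cell (h.restrict D) a (.inl i) ↔ m ∈ Cell h a (.inl i) := by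
  simp only [Cell, Set.mem_ofPred_eq, mem_dom_restrict, hm, and_true]

theorem mem_cell_restrict_seg {m : Loc} (i : I) :
    m ∈ Cell (h.restrict D) a (.inr (some i)) ↔ m ∈ Cell h a (.inr (some i)) ∧
      ∃ j, (h.restrict D).Walk (Set.range a) (a i) (a j) := by
  simp only [Cell, Set.mem_ofPred_eq, segAt_restrict_iff, Set.exists_range_iff]

theorem mem_cell_rest_iff {m : Loc} :
    m ∈ Cell h a (.inr none) ↔ m ∈ h.dom ∧ (∀ i, m ∉ Cell h a (.inl i)) ∧
      ∀ i, m ∉ Cell h a (.inr (some i)) := by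
  refine and_congr_right fun hm => and_congr_left fun _ => ⟨fun hr i hi => hr ⟨i, hi.1.symm⟩, ?_⟩
  rintro hr ⟨i, hi⟩
  exact hr i ⟨hi.symm, hm⟩

end Cells

/-! ### Splitting class by class. -/

/-- This is why thresholds add under `∗`. A part below its threshold is copied exactly and the other
part takes what is left; if both parts reach their thresholds, then `n ≥ α₁ + α₂` and `α₁` elements
go to the first. -/
theorem exists_split_card {α₁ α₂ x y n : ℕ} (hn : min (α₁ + α₂) (x + y) = min (α₁ + α₂) n) :
    ∃ k ≤ n, min α₁ x = min α₁ k ∧ min α₂ y = min α₂ (n - k) := by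
  rcases lt_or_ge x α₁ with hx | hx
  · exact ⟨x, by omega, rfl, by omega⟩
  · rcases lt_or_ge y α₂ with hy | hy
    · exact ⟨n - y, by omega, by omega, by omega⟩
    · exact ⟨α₁, by omega, by omega, by omega⟩

theorem exists_split_set {α₁ α₂ : ℕ} {X X' : Set Loc} (hX : X.Finite) (hX' : X'.Finite)
    (D : Set Loc) (hn : min (α₁ + α₂) X.ncard = min (α₁ + α₂) X'.ncard) :
    ∃ Y ⊆ X', min α₁ (X ∩ D).ncard = min α₁ Y.ncard ∧
      min α₂ (X ∩ Dᶜ).ncard = min α₂ (X' \ Y).ncard := by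
  rw [← Set.ncard_inter_add_ncard_sdiff_eq_ncard X D hX, Set.sdiff_eq] at hn
  obtain ⟨k, hk, h1, h2⟩ := exists_split_card hn
  obtain ⟨Y, hY, rfl⟩ := Set.exists_subset_card_eq hk
  exact ⟨Y, hY, h1, by rw [Set.ncard_sdiff hY (hX'.subset hY), h2]⟩

namespace Sim

variable {q α : ℕ} {I : Type} {s s' : Store} {h h' : Heap} {a a' : I → Loc}

theorem nonempty_iff_of_min_ncard_eq {α : ℕ} {X X' : Set Loc} (hα : 1 ≤ α) (hX : X.Finite) (hX' : X'.Finite)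
    (hn : min α X.ncard = min α X'.ncard) : X.Nonempty ↔ X'.Nonempty := by
  rw [← Set.ncard_pos hX, ← Set.ncard_pos hX']
  omega

/-- Both thresholds enter even though only one piece is considered: the first detects that the
source is kept, the second that nothing of the segment was lost to the other piece. -/
theorem restrict_walk_iff {α₁ α₂ : ℕ} (hα₁ : 1 ≤ α₁) (hα₂ : 1 ≤ α₂)
    (H : Sim q α s h a s' h' a') {D D' : Set Loc}
    (h₁ : ∀ c, min α₁ (Cell h a c ∩ D).ncard = min α₁ (Cell h' a' c ∩ D').ncard)
    (h₂ : ∀ c, min α₂ (Cell h a c ∩ Dᶜ).ncard = min α₂ (Cell h' a' c ∩ D'ᶜ).ncard) (i j : I) :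
    (h.restrict D).Walk (Set.range a) (a i) (a j) ↔
      (h'.restrict D').Walk (Set.range a') (a' i) (a' j) := by
  rw [walk_restrict_iff_cell, walk_restrict_iff_cell, H.walk_iff,
    nonempty_iff_of_min_ncard_eq hα₁ ((finite_cell _ _ _).inter_of_left _)
      ((finite_cell _ _ _).inter_of_left _) (h₁ _),
    ← Set.not_nonempty_iff_eq_empty, ← Set.not_nonempty_iff_eq_empty,
    nonempty_iff_of_min_ncard_eq hα₂ ((finite_cell _ _ _).inter_of_left _)
      ((finite_cell _ _ _).inter_of_left _) (h₂ _)]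

/-- Similarity is inherited by restrictions that split all classes of cells alike. -/
theorem restrict [Finite I] {α₁ α₂ : ℕ} (hα₁ : 1 ≤ α₁) (hα₂ : 1 ≤ α₂)
    (H : Sim q α s h a s' h' a') {D D' : Set Loc}
    (h₁ : ∀ c, min α₁ (Cell h a c ∩ D).ncard = min α₁ (Cell h' a' c ∩ D').ncard)
    (h₂ : ∀ c, min α₂ (Cell h a c ∩ Dᶜ).ncard = min α₂ (Cell h' a' c ∩ D'ᶜ).ncard) :
    Sim q α₁ s (h.restrict D) a s' (h'.restrict D') a' := by
  have hwalk := H.restrict_walk_iff hα₁ hα₂ h₁ h₂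
  refine ⟨H.inj, H.inj', H.vars, H.sep.restrict D, H.sep'.restrict D', hwalk, fun c₀ => ?_⟩
  have hsub : ∀ {g : Heap} {b : I → Loc} {E : Set Loc},
      Cell (g.restrict E) b c₀ ⊆ ⋃ c, Cell g b c ∩ E := by
    intro g b E m hm
    obtain ⟨h1, h2⟩ := mem_dom_restrict.1 (cell_subset_dom _ _ _ hm)
    rw [← Set.iUnion_inter]
    exact ⟨dom_subset_iUnion_cell g b h1, h2⟩
  -- Each class of the restricted heap is a union of the traces on `D` of the old classes: a segment
  -- survives whole as a segment, or what remains of it joins the rest.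
  refine min_ncard_eq_of_classes hα₁ (fun c => (finite_cell h a c).inter_of_left D)
    (fun c => (finite_cell h' a' c).inter_of_left D')
    (fun c d hcd => (pairwise_disjoint_cell H.inj H.sep hcd).mono
      Set.inter_subset_left Set.inter_subset_left)
    (fun c d hcd => (pairwise_disjoint_cell H.inj' H.sep' hcd).mono
      Set.inter_subset_left Set.inter_subset_left) h₁ hsub hsub ?_
  rintro c m ⟨hm, hmD⟩ m' ⟨hm', hmD'⟩
  have hinl : ∀ i, m ∈ Cell (h.restrict D) a (.inl i) ↔
      m' ∈ Cell (h'.restrict D') a' (.inl i) := fun i => by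
    rw [mem_cell_restrict_inl hmD, mem_cell_restrict_inl hmD', mem_cell_iff_eq H.inj H.sep hm,
      mem_cell_iff_eq H.inj' H.sep' hm']
  have hseg : ∀ i, m ∈ Cell (h.restrict D) a (.inr (some i)) ↔
      m' ∈ Cell (h'.restrict D') a' (.inr (some i)) := fun i => by
    rw [mem_cell_restrict_seg, mem_cell_restrict_seg, mem_cell_iff_eq H.inj H.sep hm,
      mem_cell_iff_eq H.inj' H.sep' hm']
    simp only [hwalk]
  rcases c₀ with i | _ | i
  · exact hinl i
  · rw [mem_cell_rest_iff, mem_cell_rest_iff, mem_dom_restrict, mem_dom_restrict]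
    simp only [hinl, hseg, hmD, hmD', cell_subset_dom h a c hm, cell_subset_dom h' a' c hm']
  · exact hseg i

/-- The classes are disjoint, so they can be split independently and `D'` can be taken as the union
of the chosen subsets. The second piece follows by exchanging the roles of `D` and its complement.
-/
theorem exists_restrict [Finite I] {α₁ α₂ : ℕ} (hα₁ : 1 ≤ α₁) (hα₂ : 1 ≤ α₂)
    (H : Sim q (α₁ + α₂) s h a s' h' a') (D : Set Loc) :
    ∃ D', Sim q α₁ s (h.restrict D) a s' (h'.restrict D') a' ∧
      Sim q α₂ s (h.restrict Dᶜ) a s' (h'.restrict D'ᶜ) a' := by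
  choose Y hY h₁ h₂ using fun c =>
    exists_split_set (finite_cell h a c) (finite_cell h' a' c) D (H.card c)
  have hinter : ∀ c, Cell h' a' c ∩ (⋃ d, Y d) = Y c := by
    intro c
    refine Set.Subset.antisymm ?_ fun m hm => ⟨hY c hm, Set.mem_iUnion.2 ⟨c, hm⟩⟩
    rintro m ⟨hc, hm⟩
    obtain ⟨d, hd⟩ := Set.mem_iUnion.1 hm
    rwa [(mem_cell_iff_eq H.inj' H.sep' hc).1 (hY d hd)]
  have hdiff : ∀ c, Cell h' a' c ∩ (⋃ d, Y d)ᶜ = Cell h' a' c \ Y c := by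
    intro c
    rw [← Set.sdiff_eq, ← Set.sdiff_self_inter, hinter]
  have h₁' : ∀ c, min α₁ (Cell h a c ∩ D).ncard = min α₁ (Cell h' a' c ∩ ⋃ d, Y d).ncard :=
    fun c => by rw [h₁, hinter]
  have h₂' : ∀ c, min α₂ (Cell h a c ∩ Dᶜ).ncard = min α₂ (Cell h' a' c ∩ (⋃ d, Y d)ᶜ).ncard :=
    fun c => by rw [h₂, hdiff]
  exact ⟨⋃ d, Y d, H.restrict hα₁ hα₂ h₁' h₂',
    H.restrict hα₂ hα₁ h₂' (by simpa only [compl_compl] using h₁')⟩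

end Sim

theorem Indist.exists_split {q α₁ α₂ : ℕ} (hα₁ : 1 ≤ α₁) (hα₂ : 1 ≤ α₂) {s s' : Store}
    {h' h₁ h₂ : Heap} (hp : h₁.Perp h₂) (H : Indist q (α₁ + α₂) s (h₁.add h₂) s' h') :
    ∃ h₁' h₂' : Heap, h₁'.Perp h₂' ∧ h₁'.add h₂' = h' ∧
      Indist q α₁ s h₁ s' h₁' ∧ Indist q α₂ s h₂ s' h₂' := by
  obtain ⟨a', hsim⟩ := H.exists_sim (by omega)
  have : Finite (Labels q s (h₁.add h₂)) := finite_labels _ _ _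
  obtain ⟨D', hs₁, hs₂⟩ := hsim.exists_restrict hα₁ hα₂ h₁.dom
  rw [← (eq_restrict_of_add hp).1] at hs₁
  rw [← (eq_restrict_of_add hp).2] at hs₂
  exact ⟨_, _, perp_restrict h' D', restrict_add_restrict h' D', hs₁.indist hα₁, hs₂.indist hα₂⟩

/-! ### Invariance of formulae under indistinguishability. -/

theorem edge_and_btw_eq_zero_iff {q : ℕ} {s : Store} {h : Heap} {l l' : Loc} :
    (Edge q s h l l' ∧ (Btw q s h l l').ncard = 0) ↔
      l ∈ Labels q s h ∧ l' ∈ Labels q s h ∧ h.val l = some l' := by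
  rw [Set.ncard_eq_zero (finite_btw q s h l l')]
  constructor
  · rintro ⟨⟨hl, hl', n, hn, hnl, hf⟩, hb⟩
    refine ⟨hl, hl', ?_⟩
    rcases hn.lt_or_eq with hlt | rfl
    · obtain ⟨m, hm, hml⟩ := iter_split hnl hn
      have : m ∈ Btw q s h l l' := by
        refine ⟨1, n - 1, le_rfl, by omega, hm, hml, fun k hk hk1 => ?_⟩
        exact hf k hk (by omega)
      rw [hb] at this
      exact absurd this (Set.notMem_empty m)
    · simpa [iter] using hnl
  · rintro ⟨hl, hl', hv⟩
    refine ⟨⟨hl, hl', walk_of_val _ hv⟩, Set.eq_empty_of_forall_notMem ?_⟩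
    rintro m ⟨L, -, hL, -, -, -, hf⟩
    exact hf 1 le_rfl hL l' hl' (by simpa [iter] using hv)

theorem pto_var_sat_iff {q : ℕ} {s : Store} {h : Heap} {x y : Fin q} :
    (TestFormula.pto (.var x) (.var y)).Sat s h ↔ h.val (s x) = some (s y) := by
  constructor
  · rintro ⟨l, l', he, hx, hy, hb⟩
    cases hx
    cases hy
    exact (edge_and_btw_eq_zero_iff.1 ⟨he, hb⟩).2.2
  · intro hv
    obtain ⟨he, hb⟩ := edge_and_btw_eq_zero_iff.2
      ⟨var_mem_labels s h x, var_mem_labels s h y, hv⟩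
    exact ⟨s x, s y, he, rfl, rfl, hb⟩

theorem Indist.symm {q α : ℕ} {s s' : Store} {h h' : Heap} (H : Indist q α s h s' h') :
    Indist q α s' h' s h :=
  fun ψ hψ => (H ψ hψ).symm

theorem Atom.sat_of_indist {q α : ℕ} (hα : 1 ≤ α) {s s' : Store} {h h' : Heap}
    (H : Indist q α s h s' h') {A : Atom} (hA : ∀ x ∈ A.vars, x < q) (hs : A.Sat s h) :
    A.Sat s' h' := by
  obtain ⟨a', hsim⟩ := H.exists_sim hα
  have : Finite (Labels q s h) := finite_labels _ _ _
  cases A with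
  | eq x y =>
    obtain ⟨l, h1, h2⟩ := (H (.eq (.var ⟨x, hA x (.inl rfl)⟩) (.var ⟨y, hA y (.inr rfl)⟩)) trivial).1
      ⟨s x, rfl, Eq.symm hs⟩
    exact Eq.trans h1 (Eq.symm h2)
  | pto x y =>
    exact pto_var_sat_iff.1 ((H (.pto (.var ⟨x, hA x (.inl rfl)⟩) (.var ⟨y, hA y (.inr rfl)⟩))
      trivial).1 (pto_var_sat_iff.2 hs))
  | reachPlus x y =>
    obtain ⟨n, hn, hxy⟩ := hs
    obtain ⟨i, hi, hi'⟩ := hsim.vars ⟨x, hA x (.inl rfl)⟩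
    obtain ⟨j, hj, hj'⟩ := hsim.vars ⟨y, hA y (.inr rfl)⟩
    simp only at hi hi' hj hj'
    rw [← hi, ← hj] at hxy
    -- `reach⁺` is a walk that has no markers to avoid.
    have hw : h.Walk (Subtype.val '' (∅ : Set (Labels q s h))) i j :=
      ⟨n, hn, hxy, fun k _ _ v hv => by simp at hv⟩
    obtain ⟨n', hn', hxy', -⟩ := hsim.walk ∅ hw (similar_self _ _ _ _ j)
    exact ⟨n', hn', by rw [← hi', ← hj']; exact hxy'⟩
  | emp =>
    -- The whole domain is a union of classes, so its size is preserved up to `α ≥ 1`, which decides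
    -- `emp`.
    have hcard : min α h.dom.ncard = min α h'.dom.ncard :=
      hsim.min_ncard_eq hα subset_rfl subset_rfl
        (fun _ _ hZ => ⟨hsim.similar_mem_dom hα hZ, hsim.symm.similar_mem_dom hα hZ.symm⟩)
        fun _ hm _ hm' => iff_of_true hm.1 hm'.1
    have hd : h.dom = ∅ := hs
    rw [hd, Set.ncard_empty] at hcard
    exact (Set.ncard_eq_zero h'.finite_dom).1 (by omega)

theorem Formula.one_le_msize (φ : Formula) : 1 ≤ φ.msize := by
  induction φ with
  | atom A => exact le_rfl
  | neg φ ih => exact ih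
  | and φ ψ ih _ => exact ih.trans (le_max_left _ _)
  | sep φ ψ ih _ => exact ih.trans (Nat.le_add_right _ _)

/-- Indistinguishable memory states satisfy the same formulae of bounded memory size. -/
theorem Formula.sat_iff_of_indist {q : ℕ} {φ : Formula} (hφ : φ.BuiltOver q) {α : ℕ}
    (hα : φ.msize ≤ α) {s s' : Store} {h h' : Heap} (H : Indist q α s h s' h') :
    φ.Sat s h ↔ φ.Sat s' h' := by
  induction φ generalizing α h h' with
  | atom A => exact ⟨Atom.sat_of_indist hα H hφ, Atom.sat_of_indist hα H.symm hφ⟩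
  | neg φ ih => exact not_congr (ih hφ hα H)
  | and φ ψ ih₁ ih₂ =>
    exact and_congr (ih₁ (fun x hx => hφ x (.inl hx)) ((le_max_left _ _).trans hα) H)
      (ih₂ (fun x hx => hφ x (.inr hx)) ((le_max_right _ _).trans hα) H)
  | sep φ ψ ih₁ ih₂ =>
    have hα' : φ.msize + ψ.msize ≤ α := hα
    have h₁ := φ.one_le_msize
    have h₂ := ψ.one_le_msize
    -- The surplus of `α` over the memory size of the conjunction is given to `ψ`.
    obtain ⟨β, rfl⟩ := Nat.exists_eq_add_of_le ((Nat.le_add_right _ _).trans hα')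
    have key : ∀ {s s' : Store} {h h' : Heap}, Indist q (φ.msize + β) s h s' h' →
        (∀ {g g'}, Indist q φ.msize s g s' g' → φ.Sat s g → φ.Sat s' g') →
        (∀ {g g'}, Indist q β s g s' g' → ψ.Sat s g → ψ.Sat s' g') →
        (φ.sep ψ).Sat s h → (φ.sep ψ).Sat s' h' := by
      rintro s s' h h' H f₁ f₂ ⟨g₁, g₂, hp, rfl, hg₁, hg₂⟩
      obtain ⟨g₁', g₂', hp', hadd, H₁, H₂⟩ := H.exists_split h₁ (by omega) hp
      exact ⟨g₁', g₂', hp', hadd, f₁ H₁ hg₁, f₂ H₂ hg₂⟩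
    have b₁ : φ.BuiltOver q := fun x hx => hφ x (.inl hx)
    have b₂ : ψ.BuiltOver q := fun x hx => hφ x (.inr hx)
    exact ⟨key H (fun G => (ih₁ b₁ le_rfl G).1) (fun G => (ih₂ b₂ (by omega) G).1),
      key H.symm (fun G => (ih₁ b₁ le_rfl G.symm).2) (fun G => (ih₂ b₂ (by omega) G.symm).2)⟩

/-! ### Boolean combinations of test formulae. -/

theorem finite_test (q α : ℕ) : (Test q α).Finite := by
  refine ((((Set.finite_range fun p : MTerm q × MTerm q => TestFormula.eq p.1 p.2).union
    (Set.finite_range fun t : MTerm q => TestFormula.alloc t)).union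
    (Set.finite_range fun p : MTerm q × MTerm q => TestFormula.pto p.1 p.2)).union
    ((Set.finite_range fun p : (MTerm q × MTerm q) × Fin (α + 1) =>
      TestFormula.sees p.1.1 p.1.2 p.2.1).union
    (Set.finite_range fun β : Fin (α + 1) => (TestFormula.sizeR β.1 : TestFormula q)))).subset ?_
  intro ψ hψ
  cases ψ with
  | eq t t' => exact .inl (.inl (.inl ⟨(t, t'), rfl⟩))
  | alloc t => exact .inl (.inl (.inr ⟨t, rfl⟩))
  | pto t t' => exact .inl (.inr ⟨(t, t'), rfl⟩)
  | sees t t' β => exact .inr (.inl ⟨((t, t'), ⟨β, Nat.lt_succ_of_le hψ.2⟩), rfl⟩)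
  | sizeR β => exact .inr (.inr ⟨⟨β, Nat.lt_succ_of_le hψ.2⟩, rfl⟩)

/-- Every property of the truth values of finitely many test formulae is expressed by a Boolean
combination. -/
theorem BoolComb.exists_of_dependsOn {q α : ℕ} (hα : 1 ≤ α) (F : Finset (Test q α))
    (P : (Test q α → Prop) → Prop)
    (hP : ∀ v w : Test q α → Prop, (∀ ψ ∈ F, v ψ ↔ w ψ) → (P v ↔ P w)) :
    ∃ χ : BoolComb (Test q α), ∀ (s : Store) (h : Heap),
      χ.Sat s h ↔ P fun ψ => ψ.1.Sat s h := by
  classical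
  induction F using Finset.induction_on generalizing P with
  | empty =>
    -- `BoolComb` has no constants, so falsity is built as a contradiction from an arbitrary test
    -- formula; `sizeR 1` is available for every `q`, including `q = 0`.
    let χ : BoolComb (Test q α) := .atom ⟨.sizeR 1, le_rfl, hα⟩
    have hχ : ∀ s h, ¬ (BoolComb.and χ (.neg χ)).Sat s h := fun s h hs => hs.2 hs.1
    by_cases h0 : P fun _ => True
    · exact ⟨.neg (.and χ (.neg χ)), fun s h =>
        iff_of_true (hχ s h) ((hP _ _ fun ψ hψ => absurd hψ (Finset.notMem_empty ψ)).1 h0)⟩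
    · exact ⟨.and χ (.neg χ), fun s h =>
        iff_of_false (hχ s h) fun h1 =>
          h0 ((hP _ _ fun ψ hψ => absurd hψ (Finset.notMem_empty ψ)).1 h1)⟩
  | insert ψ₀ F hψ₀ ih =>
    have hupd : ∀ (b : Prop), ∃ χ : BoolComb (Test q α), ∀ (s : Store) (h : Heap),
        χ.Sat s h ↔ P (Function.update (fun ψ => ψ.1.Sat s h) ψ₀ b) := by
      intro b
      refine ih (fun v => P (Function.update v ψ₀ b)) fun v w hvw => hP _ _ fun ψ hψ => ?_
      by_cases he : ψ = ψ₀
      · subst he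
        simp
      · simpa [he] using hvw ψ ((Finset.mem_insert.1 hψ).resolve_left he)
    obtain ⟨χ₁, h₁⟩ := hupd True
    obtain ⟨χ₂, h₂⟩ := hupd False
    -- Case distinction on `ψ₀`: if it holds then `χ₁`, if not then `χ₂`.
    refine ⟨.and (.neg (.and (.atom ψ₀) (.neg χ₁))) (.neg (.and (.neg (.atom ψ₀)) (.neg χ₂))),
      fun s h => ?_⟩
    simp only [BoolComb.Sat, h₁, h₂]
    by_cases hs : ψ₀.1.Sat s h
    · have : Function.update (fun ψ : Test q α => ψ.1.Sat s h) ψ₀ True = fun ψ => ψ.1.Sat s h :=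
        Function.update_eq_self_iff.2 (eq_true hs).symm
      rw [this]
      tauto
    · have : Function.update (fun ψ : Test q α => ψ.1.Sat s h) ψ₀ False = fun ψ => ψ.1.Sat s h :=
        Function.update_eq_self_iff.2 (eq_false hs).symm
      rw [this]
      tauto

/-- Every formula is equivalent to a Boolean combination of test formulae. -/
theorem Formula.exists_boolComb {q : ℕ} {φ : Formula} (hφ : φ.BuiltOver q) :
    ∃ χ : BoolComb (Test q φ.msize), ∀ (s : Store) (h : Heap), φ.Sat s h ↔ χ.Sat s h := by
  have : Fintype (Test q φ.msize) := (finite_test q φ.msize).fintype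
  obtain ⟨χ, hχ⟩ := BoolComb.exists_of_dependsOn φ.one_le_msize Finset.univ
    -- The property of a valuation is that some model of `φ` realises it. By invariance, every state
    -- with that valuation is then a model.
    (fun v => ∃ s h, (∀ ψ : Test q φ.msize, ψ.1.Sat s h ↔ v ψ) ∧ φ.Sat s h) (by
      intro v w hvw
      simp only [fun ψ => hvw ψ (Finset.mem_univ ψ)])
  refine ⟨χ, fun s h => ?_⟩
  rw [hχ]
  constructor
  · exact fun hs => ⟨s, h, fun _ => Iff.rfl, hs⟩
  · rintro ⟨s', h', hv, hs⟩
    exact (Formula.sat_iff_of_indist hφ le_rfl fun ψ hψ => hv ⟨ψ, hψ⟩).1 hs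

end SLReach

theorem mainTheorem3 (q : ℕ) :
    (∀ φ : SLReach.Formula, φ.BuiltOver q →
      ∃ χ : SLReach.BoolComb (SLReach.Test q φ.msize),
        ∀ (s : SLReach.Store) (h : SLReach.Heap), φ.Sat s h ↔ χ.Sat s h) ∧
    (∀ φ : SLReach.Formula, φ.BuiltOver q → ∀ α : ℕ, φ.msize ≤ α →
      ∀ (s : SLReach.Store) (h : SLReach.Heap) (s' : SLReach.Store) (h' : SLReach.Heap),
        SLReach.Indist q α s h s' h' → (φ.Sat s h ↔ φ.Sat s' h')) ∧
    (∀ α α₁ α₂ : ℕ, 1 ≤ α₁ → 1 ≤ α₂ → α = α₁ + α₂ →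
      ∀ (s : SLReach.Store) (h : SLReach.Heap) (s' : SLReach.Store) (h' : SLReach.Heap),
        SLReach.Indist q α s h s' h' →
        ∀ h₁ h₂ : SLReach.Heap, h₁.Perp h₂ → h₁.add h₂ = h →
          ∃ h₁' h₂' : SLReach.Heap, h₁'.Perp h₂' ∧ h₁'.add h₂' = h' ∧
            SLReach.Indist q α₁ s h₁ s' h₁' ∧ SLReach.Indist q α₂ s h₂ s' h₂') := by
  refine ⟨fun φ hφ => SLReach.Formula.exists_boolComb hφ,
    fun φ hφ α hα s h s' h' H => SLReach.Formula.sat_iff_of_indist hφ hα H, ?_⟩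
  rintro α α₁ α₂ hα₁ hα₂ rfl s h s' h' H h₁ h₂ hp rfl
  exact H.exists_split hα₁ hα₂ hp
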